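/- Let $m_1,m_2,T>0$. There is a constant $C=C(m_1,m_2,T)>0$ such that the following holds for every period length $L>0$. Let $\phi=\phi(\alpha,t)$ be a strong solution on $[0,T]$ of $$\phi_t=-\partial_\alpha\Big(\frac1{\phi_\alpha}\,\partial_\alpha\mu\Big),\qquad \mu=\frac{2\pi}{L^2}\,\mathrm{PV}\!\!\int_0^1\cot\frac{\pi(\phi(\alpha)-\phi(\beta))}{L}\,d\beta-\frac{\phi_{\alpha\alpha}}{\phi_\alpha^2}-3\frac{\phi_{\alpha\alpha}}{\phi_\alpha^4},$$ with $\phi\in L^\infty([0,T];W^{6,\infty}_{\mathrm{loc}}(\mathbb R))$, $\phi_t\in L^\infty$ and $\phi(\alpha+1,t)-\phi(\alpha,t)=-L$, and suppose that $\phi_\alpha\le -m_1$ and $|\partial_\alpha^i\phi|\le m_2$ for $i=1,\dots,6$ on $[0,T]$ (almost everywhere). Let $N\ge1$, $a=1/N$, $\alpha_i=(N-i)/N$ and $y_i(t)=\phi(\alpha_i,t)$ for $i\in\mathbb Z$, so that $y_{i+N}=y_i+L$. Put $$M_i=\frac1{y_{i+1}-y_i}+\frac{a^2}{(y_{i+1}-y_i)^3}-\frac1{y_i-y_{i-1}}-\frac{a^2}{(y_i-y_{i-1})^3}-\frac2L\sum_{j\ne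 i}\frac a{y_j-y_i},$$ and, for a sequence $z=(z_i)_{i\in\mathbb Z}$, $$T_i=-\frac{z_{i+1}-z_i}{(y_{i+1}-y_i)^2}-3a^2\frac{z_{i+1}-z_i}{(y_{i+1}-y_i)^4}+\frac{z_i-z_{i-1}}{(y_i-y_{i-1})^2}+3a^2\frac{z_i-z_{i-1}}{(y_i-y_{i-1})^4}+\frac2L\sum_{j\ne i}\frac{a(z_j-z_i)}{(y_j-y_i)^2},$$ where the sums run over $j\in\mathbb Z\setminus\{i\}$ and are taken symmetrically about $i$. Let $z(t)$, with $z_{i+N}=z_i$, solve on $[0,T]$ the linearized step equation $$\dot z_i=\frac1a\Big(\frac{T_{i+1}-T_i}{y_{i+1}-y_i}-\frac{T_i-T_{i-1}}{y_i-y_{i-1}}\Big)-\frac1a\Big[\frac{z_{i+1}-z_i}{(y_{i+1}-y_i)^2}(M_{i+1}-M_i)-\frac{z_i-z_{i-1}}{(y_i-y_{i-1})^2}(M_i-M_{i-1})\Big].$$ Then, with $\|z\|_{\ell^2}^2=\sum_{i=1}^N a\,z_i^2$, $$\|z(t)\|_{\ell^2}\le C\,\|z(0)\|_{\ell^2}\qquad\text{for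 all }t\in[0,T].$$ In particular $C$ does not depend on $a$. -/

import Mathlib

open Set Filter Topology MeasureTheory

noncomputable section

/-- The space `W^{6,∞}` of step-location profiles of period length `L`: functions on `ℝ` with
`f (α + 1) - f α = -L` and weak derivatives up to order six in `L^∞_loc`. In one dimension this
means (for the continuous representative) that `f` is `C⁵` with Lipschitz fifth derivative; the
sixth derivative then exists almost everywhere and is the sixth weak derivative. -/
structure IsStepProfile (L : ℝ) (f : ℝ → ℝ) : Prop where
  contDiff : ContDiff ℝ 5 f
  lipschitz : ∃ K, LipschitzWith K (iteratedDeriv 5 f)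
  quasiPeriodic : ∀ α, f (α + 1) - f α = -L

/-- `v` is the Cauchy principal value at the point `α` of the integral over one period of the
`1`-periodic function `g`, singular (modulo `1`) at `α` only. -/
def HasPeriodPV (g : ℝ → ℝ) (α v : ℝ) : Prop :=
  Tendsto (fun δ : ℝ => (∫ β in (α - 1 / 2)..(α - δ), g β) + ∫ β in (α + δ)..(α + 1 / 2), g β)
    (𝓝[>] 0) (𝓝 v)

/-- `μ` is the chemical potential `δE/δφ` of the step-location profile `f`. -/
def IsChemicalPotential (L : ℝ) (f μ : ℝ → ℝ) : Prop :=
  ∀ α, ∃ P, HasPeriodPV (fun β => Real.cot (Real.pi * (f α - f β) / L)) α P ∧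
    μ α = 2 * Real.pi / L ^ 2 * P - iteratedDeriv 2 f α / (deriv f α) ^ 2
      - 3 * (iteratedDeriv 2 f α / (deriv f α) ^ 4)

/-- `φ` (written `φ t α`) is a strong solution on `[0, T]` of
`φ_t = -∂_α ((1 / φ_α) ∂_α (δE/δφ))`, with `φ ∈ L^∞([0,T]; W^{6,∞})`, `φ_t ∈ L^∞`. -/
structure IsStrongSolution (L T : ℝ) (φ : ℝ → ℝ → ℝ) : Prop where
  lipschitz_time : ∃ K, ∀ α, LipschitzOnWith K (fun t => φ t α) (Icc 0 T)
  profile : ∀ᵐ t ∂(volume.restrict (Icc 0 T)), IsStepProfile L (φ t)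
  bounded : ∃ B : ℝ, ∀ᵐ t ∂(volume.restrict (Icc 0 T)), ∀ i ∈ Finset.range 7,
    ∀ᵐ α ∂(volume.restrict (Icc (0 : ℝ) 1)), |iteratedDeriv i (φ t) α| ≤ B
  equation : ∀ᵐ t ∂(volume.restrict (Icc 0 T)), ∃ μ : ℝ → ℝ,
    IsChemicalPotential L (φ t) μ ∧ ContDiff ℝ 2 μ ∧
      ∀ᵐ α : ℝ, HasDerivAt (fun s => φ s α)
        (-deriv (fun β => deriv μ β / deriv (φ t) β) α) t

/-- `φ_α ≤ -m₁` and `|∂_α^i φ| ≤ m₂` for `i = 1, …, 6`, on `[0, T]`. -/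
def HasProfileBounds (m₁ m₂ T : ℝ) (φ : ℝ → ℝ → ℝ) : Prop :=
  ∀ᵐ t ∂(volume.restrict (Icc 0 T)),
    (∀ α, deriv (φ t) α ≤ -m₁) ∧
      ∀ i ∈ Finset.Icc 1 6, ∀ᵐ α : ℝ, |iteratedDeriv i (φ t) α| ≤ m₂

/-- The nodal values `y_i = f (α_i)`, `α_i = (N - i) / N`, `i ∈ ℤ`. -/
def nodal (N : ℕ) (f : ℝ → ℝ) (i : ℤ) : ℝ := f (((N : ℝ) - i) / N)

/-- The sum `∑_{j ≠ i} g j` over `j ∈ ℤ`, summed symmetrically about `i`. -/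
def symSum (g : ℤ → ℝ) (i : ℤ) : ℝ :=
  ∑' k : ℕ, (g (i + ((k : ℤ) + 1)) + g (i - ((k : ℤ) + 1)))

/-- The chemical potential `M_i` of the steps `y`, with step height `a`. -/
def stepM (L a : ℝ) (y : ℤ → ℝ) (i : ℤ) : ℝ :=
  1 / (y (i + 1) - y i) + a ^ 2 / (y (i + 1) - y i) ^ 3
    - 1 / (y i - y (i - 1)) - a ^ 2 / (y i - y (i - 1)) ^ 3
    - 2 / L * symSum (fun j => a / (y j - y i)) i

/-- The linearization `T_i` of `M_i` at `y` in the direction `z`. -/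
def stepT (L a : ℝ) (y z : ℤ → ℝ) (i : ℤ) : ℝ :=
  -((z (i + 1) - z i) / (y (i + 1) - y i) ^ 2)
    - 3 * a ^ 2 * ((z (i + 1) - z i) / (y (i + 1) - y i) ^ 4)
    + (z i - z (i - 1)) / (y i - y (i - 1)) ^ 2
    + 3 * a ^ 2 * ((z i - z (i - 1)) / (y i - y (i - 1)) ^ 4)
    + 2 / L * symSum (fun j => a * (z j - z i) / (y j - y i) ^ 2) i

/-- The right-hand side of the linearized step equation. -/
def linRHS (L a : ℝ) (y z : ℤ → ℝ) (i : ℤ) : ℝ :=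
  1 / a * ((stepT L a y z (i + 1) - stepT L a y z i) / (y (i + 1) - y i)
      - (stepT L a y z i - stepT L a y z (i - 1)) / (y i - y (i - 1)))
    - 1 / a * ((z (i + 1) - z i) / (y (i + 1) - y i) ^ 2 * (stepM L a y (i + 1) - stepM L a y i)
      - (z i - z (i - 1)) / (y i - y (i - 1)) ^ 2 * (stepM L a y i - stepM L a y (i - 1)))

/-- `z` is an `N`-periodic solution on `[0, T]` of the linearized step equation about `y`, with
step height `a = 1 / N`. -/
structure IsLinearizedSolution (N : ℕ) (L T : ℝ) (y z : ℝ → ℤ → ℝ) : Prop where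
  periodic : ∀ t ∈ Icc 0 T, ∀ i, z t (i + N) = z t i
  ode : ∀ t ∈ Icc 0 T, ∀ i,
    HasDerivWithinAt (fun s => z s i) (linRHS L (1 / (N : ℝ)) (y t) (z t) i) (Icc 0 T) t

/-- The norm `‖z‖_{ℓ²} = (∑_{i=1}^N a z_i²)^{1/2}`, `a = 1 / N`. -/
def ellTwoNorm (N : ℕ) (z : ℤ → ℝ) : ℝ :=
  √(∑ i ∈ Finset.Icc (1 : ℤ) N, 1 / (N : ℝ) * z i ^ 2)

end

/-!
Only the a priori bounds on the profile enter; the evolution equation for `φ` plays no role. They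
make the nodal values `y_i` increase at rate comparable to the mesh size `a`, with second and third
differences of order `a²` and `a³` (`IsRegularSteps`), at every time
(`regularSteps_of_strongSolution`). It then suffices to bound the linearized right-hand side as a
quadratic form on `ℓ²`, uniformly in `a` (`exists_sum_mul_linRHS_le`), and to apply Grönwall's
inequality.

Write `h_i = (y_{i+1} - y_i) / a`, `v` and `w` for the first and second difference quotients of `z`,
and `Z`, `V`, `W` for the norms of `z`, `v`, `w`. Two summations by parts (`sum_mul_linRHS_eq`) turn
`∑ a z_i ż_i` into `∑ a A_i T_i + ∑ a c_i v_i²`, where `A_i = w_i / h_i + O(|v|)`,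
`T_i = -(1 / h_i² + 3 / h_i⁴) w_i + O(|v|) + (2 / L) R_i` with `R` the linearized interaction, and
`c_i = (M_{i+1} - M_i) / (a h_i²)`. The product `A_i T_i` dissipates a multiple of `W²`
(`energy_density_le`), and everything else is of lower order:

* `c` is bounded, because `M` is Lipschitz uniformly in `a` (`exists_abs_stepM_sub_le`). In its
  interaction part the two simple poles at distance `s` on either side nearly cancel, and the
  variation of the pair from one step to the next is `O(a min(1, s⁻²))`, which sums to `O(a)`.
* `V² ≤ Z W` by summation by parts (`ellTwoNorm_diffQuot_sq_le`).
* The pair of terms at distance `s` in `R` has norm at most a constant times `W + V`, and at most a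
  constant times `Z / s²`. The first bound for `s ≤ δ` and the second for `s ≥ δ` give
  `‖R‖ ≤ C (δ (W + V) + Z / δ)` for every `δ > 0` (`ellTwoNorm_symSum_linearized_le`). No sharp
  bound for the discrete Hilbert transform is needed.

For small `δ` the dissipation absorbs all terms except a multiple of `Z²` (`exists_absorb`).
-/

/-! ### The discrete norm on periodic sequences -/

theorem ellTwoNorm_nonneg (N : ℕ) (u : ℤ → ℝ) : 0 ≤ ellTwoNorm N u := Real.sqrt_nonneg _

theorem ellTwoNorm_sq (N : ℕ) (u : ℤ → ℝ) :
    ellTwoNorm N u ^ 2 = ∑ i ∈ Finset.Icc (1 : ℤ) N, 1 / (N : ℝ) * u i ^ 2 :=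
  Real.sq_sqrt (Finset.sum_nonneg fun _ _ => by positivity)

theorem ellTwoNorm_zero (N : ℕ) : ellTwoNorm N (fun _ => 0) = 0 := by
  simp [ellTwoNorm]

theorem sum_mul_le_ellTwoNorm_mul (N : ℕ) (u v : ℤ → ℝ) :
    |∑ i ∈ Finset.Icc (1 : ℤ) N, 1 / (N : ℝ) * (u i * v i)| ≤
      ellTwoNorm N u * ellTwoNorm N v := by
  apply abs_le_of_sq_le_sq _ (mul_nonneg (ellTwoNorm_nonneg _ _) (ellTwoNorm_nonneg _ _))
  rw [mul_pow, ellTwoNorm_sq, ellTwoNorm_sq]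
  exact Finset.sum_sq_le_sum_mul_sum_of_sq_le_mul _ (fun _ _ => by positivity)
    (fun _ _ => by positivity) (fun i _ => le_of_eq (by ring))

theorem ellTwoNorm_add_le (N : ℕ) (u v : ℤ → ℝ) :
    ellTwoNorm N (fun i => u i + v i) ≤ ellTwoNorm N u + ellTwoNorm N v := by
  have hu := ellTwoNorm_nonneg N u
  have hv := ellTwoNorm_nonneg N v
  refine le_of_sq_le_sq ?_ (add_nonneg hu hv)
  have h := (abs_le.1 (sum_mul_le_ellTwoNorm_mul N u v)).2
  have : ellTwoNorm N (fun i => u i + v i) ^ 2 = ellTwoNorm N u ^ 2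
      + 2 * (∑ i ∈ Finset.Icc (1 : ℤ) N, 1 / (N : ℝ) * (u i * v i)) + ellTwoNorm N v ^ 2 := by
    simp only [ellTwoNorm_sq, Finset.mul_sum, ← Finset.sum_add_distrib]
    exact Finset.sum_congr rfl fun i _ => by ring
  rw [this]
  nlinarith

theorem ellTwoNorm_sum_le (N n : ℕ) (u : ℕ → ℤ → ℝ) :
    ellTwoNorm N (fun i => ∑ k ∈ Finset.range n, u k i) ≤
      ∑ k ∈ Finset.range n, ellTwoNorm N (u k) := by
  induction n with
  | zero => simp [ellTwoNorm_zero]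
  | succ n ih =>
    simp only [Finset.sum_range_succ]
    exact (ellTwoNorm_add_le _ _ _).trans (by gcongr)

theorem ellTwoNorm_le_mul_of_abs_le {N : ℕ} {u v : ℤ → ℝ} {c : ℝ} (hc : 0 ≤ c)
    (h : ∀ i, |u i| ≤ c * |v i|) : ellTwoNorm N u ≤ c * ellTwoNorm N v := by
  refine le_of_sq_le_sq ?_ (mul_nonneg hc (ellTwoNorm_nonneg _ _))
  rw [mul_pow, ellTwoNorm_sq, ellTwoNorm_sq, Finset.mul_sum]
  refine Finset.sum_le_sum fun i _ => ?_
  have := pow_le_pow_left₀ (abs_nonneg _) (h i) 2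
  rw [mul_pow, sq_abs, sq_abs] at this
  calc 1 / (N : ℝ) * u i ^ 2 ≤ 1 / (N : ℝ) * (c ^ 2 * v i ^ 2) := by gcongr
    _ = _ := by ring

/-- The sum of a periodic sequence over one period is invariant under translation. -/
theorem sum_period_add_one {N : ℕ} {u : ℤ → ℝ} (hu : ∀ i, u (i + N) = u i) :
    ∑ i ∈ Finset.Icc (1 : ℤ) N, u (i + 1) = ∑ i ∈ Finset.Icc (1 : ℤ) N, u i := by
  have key : ∀ f : ℤ → ℝ, ∑ i ∈ Finset.Icc (1 : ℤ) N, f i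
      = ∑ k ∈ Finset.range N, f ((k : ℤ) + 1) := by
    intro f
    symm
    refine Finset.sum_bij (fun k _ => (k : ℤ) + 1) ?_ ?_ ?_ ?_
    · intro k hk; simp at hk ⊢; omega
    · intro k _ l _ h; simpa using h
    · intro b hb
      simp only [Finset.mem_Icc] at hb
      exact ⟨(b - 1).toNat, by simp; omega, by omega⟩
    · intros; rfl
  rw [key, key]
  have h1 := Finset.sum_range_succ (fun k : ℕ => u ((k : ℤ) + 1)) N
  rw [Finset.sum_range_succ'] at h1
  have h2 := hu 1
  push_cast at h1
  rw [add_comm (1 : ℤ)] at h2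
  simp only [add_assoc] at h1 ⊢
  linarith

theorem ellTwoNorm_add_one {N : ℕ} {u : ℤ → ℝ} (hu : ∀ i, u (i + N) = u i) :
    ellTwoNorm N (fun i => u (i + 1)) = ellTwoNorm N u := by
  unfold ellTwoNorm
  rw [sum_period_add_one (u := fun i => 1 / (N : ℝ) * u i ^ 2) (fun i => by simp [hu])]

theorem ellTwoNorm_add_nat {N : ℕ} {u : ℤ → ℝ} (hu : ∀ i, u (i + N) = u i) (k : ℕ) :
    ellTwoNorm N (fun i => u (i + k)) = ellTwoNorm N u := by
  induction k with
  | zero => simp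
  | succ k ih =>
    rw [← ih, ← ellTwoNorm_add_one (u := fun i => u (i + k))
      (fun i => by rw [add_right_comm, hu])]
    congr 1; ext i; congr 1; push_cast; ring

theorem ellTwoNorm_sub_nat {N : ℕ} {u : ℤ → ℝ} (hu : ∀ i, u (i + N) = u i) (k : ℕ) :
    ellTwoNorm N (fun i => u (i - k)) = ellTwoNorm N u := by
  rw [← ellTwoNorm_add_nat (u := fun i => u (i - k))
    (fun i => by rw [add_sub_right_comm, hu]) k]
  simp

theorem ellTwoNorm_add_nat_sub_le {N : ℕ} {u : ℤ → ℝ} (hu : ∀ i, u (i + N) = u i) (k : ℕ) :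
    ellTwoNorm N (fun i => u (i + k) - u i) ≤ k * ellTwoNorm N (fun i => u (i + 1) - u i) := by
  induction k with
  | zero => simp [ellTwoNorm_zero]
  | succ k ih =>
    have h1 := ellTwoNorm_add_nat (u := fun i => u (i + 1) - u i)
      (fun i => by rw [add_right_comm, hu, hu]) k
    have h2 := ellTwoNorm_add_le N (fun i => u (i + k) - u i)
      (fun i => u (i + k + 1) - u (i + k))
    have h3 : (fun i : ℤ => u (i + (k + 1 : ℕ)) - u i)
        = fun i => (u (i + k) - u i) + (u (i + k + 1) - u (i + k)) := by
      ext i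
      have : i + ((k + 1 : ℕ) : ℤ) = i + k + 1 := by push_cast; ring
      rw [this]; ring
    rw [h3]
    push_cast
    linarith

theorem ellTwoNorm_sub_nat_sub_le {N : ℕ} {u : ℤ → ℝ} (hu : ∀ i, u (i + N) = u i) (k : ℕ) :
    ellTwoNorm N (fun i => u (i - k) - u i) ≤ k * ellTwoNorm N (fun i => u (i + 1) - u i) := by
  refine le_trans (le_of_eq ?_) (ellTwoNorm_add_nat_sub_le hu k)
  rw [← ellTwoNorm_add_nat (u := fun i => u (i - k) - u i)
    (fun i => by rw [add_sub_right_comm, hu, hu]) k]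
  unfold ellTwoNorm
  congr 1
  refine Finset.sum_congr rfl fun i _ => ?_
  simp only [add_sub_cancel_right]
  ring

theorem ellTwoNorm_second_difference_le {N : ℕ} {u : ℤ → ℝ} (hu : ∀ i, u (i + N) = u i)
    (k : ℕ) :
    ellTwoNorm N (fun i => u (i + k) - 2 * u i + u (i - k)) ≤
      (k : ℝ) ^ 2 * ellTwoNorm N (fun i => u (i + 1) - 2 * u i + u (i - 1)) := by
  -- The `k`-step second difference is the `k`-step difference of the `k`-step difference.
  have hg : ∀ i, (fun i => u i - u (i - k)) (i + N) = (fun i => u i - u (i - k)) i := by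
    intro i; simp only [add_sub_right_comm, hu]
  have h1 := ellTwoNorm_add_nat_sub_le (u := fun i => u i - u (i - k)) hg k
  have h2 := ellTwoNorm_sub_nat_sub_le (u := fun i => u (i + 1) - u i)
    (fun i => by rw [add_right_comm, hu, hu]) k
  have h3 := ellTwoNorm_add_one (N := N) (u := fun i => u (i + 1) - 2 * u i + u (i - 1))
    (fun i => by simp only [add_sub_right_comm, add_right_comm _ (N : ℤ) 1, hu])
  have e1 : (fun i => u (i + k) - 2 * u i + u (i - k))
      = fun i => (u (i + k) - u (i + k - k)) - (u i - u (i - k)) := by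
    ext i; rw [add_sub_cancel_right]; ring
  have e2 : ellTwoNorm N (fun i => (u (i + 1) - u (i + 1 - k)) - (u i - u (i - k)))
      = ellTwoNorm N (fun i => (u (i - k + 1) - u (i - k)) - (u (i + 1) - u i)) := by
    unfold ellTwoNorm
    congr 1
    refine Finset.sum_congr rfl fun i _ => ?_
    simp only [add_sub_right_comm]; ring
  have e3 : (fun i => u (i + 1 + 1) - u (i + 1) - (u (i + 1) - u i))
      = fun i => u (i + 1 + 1) - 2 * u (i + 1) + u (i + 1 - 1) := by
    ext i; rw [add_sub_cancel_right]; ring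
  rw [e1]
  refine h1.trans ?_
  rw [e2, sq, mul_assoc]
  refine mul_le_mul_of_nonneg_left ?_ (Nat.cast_nonneg k)
  rw [← h3, ← e3]
  exact h2

/-! ### Differences of sequences -/

theorem abs_add_nat_sub_le {u : ℤ → ℝ} {c : ℝ} (h : ∀ i, |u (i + 1) - u i| ≤ c) (k : ℕ)
    (i : ℤ) : |u (i + k) - u i| ≤ k * c := by
  induction k with
  | zero => simp
  | succ k ih =>
    have h1 := h (i + k)
    have : i + ((k + 1 : ℕ) : ℤ) = i + k + 1 := by push_cast; ring
    rw [this]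
    have := abs_add_le (u (i + k + 1) - u (i + k)) (u (i + k) - u i)
    rw [sub_add_sub_cancel] at this
    push_cast
    linarith

theorem abs_second_difference_le {u : ℤ → ℝ} {c : ℝ}
    (h : ∀ i, |u (i + 1) - 2 * u i + u (i - 1)| ≤ c) (k : ℕ) (i : ℤ) :
    |u (i + k) - 2 * u i + u (i - k)| ≤ (k : ℝ) ^ 2 * c := by
  have h1 : ∀ i, |(u (i + 1) - u i) - (u (i + 1 - k) - u (i - k))| ≤ k * c := by
    intro i
    have := abs_add_nat_sub_le (u := fun i => u (i + 1) - u i) (c := c) (fun i => by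
      have := h (i + 1)
      rw [add_sub_cancel_right] at this
      convert this using 2; ring) k (i - k)
    simp only [sub_add_cancel] at this
    rwa [show i - (k : ℤ) + 1 = i + 1 - k by ring] at this
  have h2 := abs_add_nat_sub_le (u := fun i => u i - u (i - k)) (c := k * c) (fun i => by
      convert h1 i using 2; ring) k i
  simp only [add_sub_cancel_right] at h2
  calc |u (i + k) - 2 * u i + u (i - k)| = |u (i + k) - u i - (u i - u (i - k))| := by
        congr 1; ring
    _ ≤ k * (k * c) := h2
    _ = _ := by ring

theorem mul_le_add_nat_sub {u : ℤ → ℝ} {c : ℝ} (h : ∀ i, c ≤ u (i + 1) - u i) (k : ℕ)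
    (i : ℤ) : k * c ≤ u (i + k) - u i := by
  induction k with
  | zero => simp
  | succ k ih =>
    have h1 := h (i + k)
    have : i + ((k + 1 : ℕ) : ℤ) = i + k + 1 := by push_cast; ring
    rw [this]
    push_cast
    linarith

/-- The sequence `u` is bounded by `c` in the discrete analogue of `C²` with mesh size `a`. -/
structure DiscreteC2 (a c : ℝ) (u : ℤ → ℝ) : Prop where
  bound : ∀ i, |u i| ≤ c
  first : ∀ i, |u (i + 1) - u i| ≤ c * a
  second : ∀ i, |u (i + 1) - 2 * u i + u (i - 1)| ≤ c * a ^ 2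

theorem DiscreteC2.add {a c d : ℝ} {u v : ℤ → ℝ} (hu : DiscreteC2 a c u)
    (hv : DiscreteC2 a d v) : DiscreteC2 a (c + d) (fun i => u i + v i) where
  bound i := (abs_add_le _ _).trans (add_le_add (hu.bound i) (hv.bound i))
  first i := by
    rw [add_sub_add_comm, add_mul]
    exact (abs_add_le _ _).trans (add_le_add (hu.first i) (hv.first i))
  second i := by
    rw [mul_add, add_sub_add_comm, add_add_add_comm, add_mul]
    exact (abs_add_le _ _).trans (add_le_add (hu.second i) (hv.second i))

theorem DiscreteC2.mul {a c d : ℝ} {u v : ℤ → ℝ} (ha : 0 ≤ a)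
    (hu : DiscreteC2 a c u) (hv : DiscreteC2 a d v) :
    DiscreteC2 a (4 * (c * d)) (fun i => u i * v i) := by
  have hc : 0 ≤ c := (abs_nonneg _).trans (hu.bound 0)
  have hd : 0 ≤ d := (abs_nonneg _).trans (hv.bound 0)
  have mul_bd : ∀ {x y b b' : ℝ}, |x| ≤ b → |y| ≤ b' → |x * y| ≤ b * b' := by
    intro x y b b' hx hy
    rw [abs_mul]
    exact mul_le_mul hx hy (abs_nonneg _) ((abs_nonneg _).trans hx)
  refine ⟨fun i => ?_, fun i => ?_, fun i => ?_⟩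
  · have := mul_bd (hu.bound i) (hv.bound i)
    nlinarith [mul_nonneg hc hd]
  · have h1 := mul_bd (hu.bound (i + 1)) (hv.first i)
    have h2 := mul_bd (hu.first i) (hv.bound i)
    have h3 := abs_add_le (u (i + 1) * (v (i + 1) - v i)) ((u (i + 1) - u i) * v i)
    have h4 := mul_nonneg (mul_nonneg hc hd) ha
    calc _ = |u (i + 1) * (v (i + 1) - v i) + (u (i + 1) - u i) * v i| := by congr 1; ring
      _ ≤ _ := by nlinarith
  · have h1 := mul_bd (hu.bound i) (hv.second i)
    have h2 := mul_bd (hu.second i) (hv.bound i)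
    have h3 := mul_bd (hu.first i) (hv.first i)
    have h4 := mul_bd (hu.first (i - 1)) (hv.first (i - 1))
    rw [sub_add_cancel] at h4
    -- the discrete Leibniz rule for second differences
    have h5 : u (i + 1) * v (i + 1) - 2 * (u i * v i) + u (i - 1) * v (i - 1)
        = u i * (v (i + 1) - 2 * v i + v (i - 1)) + (u (i + 1) - 2 * u i + u (i - 1)) * v i
          + (u (i + 1) - u i) * (v (i + 1) - v i)
          + (u i - u (i - 1)) * (v i - v (i - 1)) := by ring
    rw [h5]
    refine (abs_add_le _ _).trans ?_
    refine (add_le_add_left (abs_add_le _ _) _).trans ?_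
    refine (add_le_add_left (add_le_add_left (abs_add_le _ _) _) _).trans ?_
    linarith

theorem DiscreteC2.one_div {a m₁ m₂ : ℝ} {h : ℤ → ℝ} (ha : 0 < a) (hm₁ : 0 < m₁)
    (hlow : ∀ i, m₁ ≤ h i) (h1 : ∀ i, |h (i + 1) - h i| ≤ m₂ * a)
    (h2 : ∀ i, |h (i + 1) - 2 * h i + h (i - 1)| ≤ m₂ * a ^ 2) :
    DiscreteC2 a (1 / m₁ + m₂ / m₁ ^ 2 + 2 * m₂ ^ 2 / m₁ ^ 3) (fun i => 1 / h i) := by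
  have hpos : ∀ i, 0 < h i := fun i => hm₁.trans_le (hlow i)
  have hm₂ : 0 ≤ m₂ := nonneg_of_mul_nonneg_left ((abs_nonneg _).trans (h1 0)) ha
  have e1 : 0 ≤ 1 / m₁ := by positivity
  have e2 : 0 ≤ m₂ / m₁ ^ 2 := by positivity
  have e3 : 0 ≤ 2 * m₂ ^ 2 / m₁ ^ 3 := by positivity
  refine ⟨fun i => ?_, fun i => ?_, fun i => ?_⟩
  · rw [abs_of_pos (by have := hpos i; positivity)]
    have := one_div_le_one_div_of_le hm₁ (hlow i)
    linarith
  · have p0 := hpos i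
    have p1 := hpos (i + 1)
    have e : 1 / h (i + 1) - 1 / h i = -(h (i + 1) - h i) / (h (i + 1) * h i) := by
      field_simp; ring
    have hb : |1 / h (i + 1) - 1 / h i| ≤ m₂ * a / m₁ ^ 2 := by
      rw [e, abs_div, abs_neg, abs_of_pos (mul_pos p1 p0), sq]
      gcongr
      exacts [h1 i, hlow _, hlow _]
    have e4 : m₂ * a / m₁ ^ 2 = m₂ / m₁ ^ 2 * a := by ring
    nlinarith
  · have p0 := hpos i
    have p1 := hpos (i + 1)
    have p2 := hpos (i - 1)
    have f1 := h1 i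
    have f2 := h1 (i - 1)
    rw [sub_add_cancel] at f2
    have f3 : |h (i + 1) - h (i - 1)| ≤ 2 * (m₂ * a) := by
      have := abs_add_le (h (i + 1) - h i) (h i - h (i - 1))
      rw [sub_add_sub_cancel] at this
      linarith
    have e : 1 / h (i + 1) - 2 * (1 / h i) + 1 / h (i - 1)
        = -(h (i + 1) - 2 * h i + h (i - 1)) / (h (i + 1) * h i)
          + (h i - h (i - 1)) * (h (i + 1) - h (i - 1)) / (h (i + 1) * h i * h (i - 1)) := by
      field_simp; ring
    have b1 : |-(h (i + 1) - 2 * h i + h (i - 1)) / (h (i + 1) * h i)|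
        ≤ m₂ * a ^ 2 / m₁ ^ 2 := by
      rw [abs_div, abs_neg, abs_of_pos (mul_pos p1 p0), sq m₁]
      gcongr
      exacts [h2 i, hlow _, hlow _]
    have b2 : |(h i - h (i - 1)) * (h (i + 1) - h (i - 1)) / (h (i + 1) * h i * h (i - 1))|
        ≤ (m₂ * a) * (2 * (m₂ * a)) / m₁ ^ 3 := by
      rw [abs_div, abs_mul, abs_of_pos (mul_pos (mul_pos p1 p0) p2), pow_succ, sq m₁]
      gcongr
      exacts [hlow _, hlow _, hlow _]
    rw [e]
    have e4 : m₂ * a ^ 2 / m₁ ^ 2 = m₂ / m₁ ^ 2 * a ^ 2 := by ring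
    have e5 : (m₂ * a) * (2 * (m₂ * a)) / m₁ ^ 3 = 2 * m₂ ^ 2 / m₁ ^ 3 * a ^ 2 := by ring
    have := abs_add_le (-(h (i + 1) - 2 * h i + h (i - 1)) / (h (i + 1) * h i))
      ((h i - h (i - 1)) * (h (i + 1) - h (i - 1)) / (h (i + 1) * h i * h (i - 1)))
    nlinarith [mul_nonneg e1 (sq_nonneg a)]

/-! ### Step sequences -/

/-- The discrete bounds on an increasing step sequence `y` with step height `a` that the energy
estimate uses: its first three differences are of the size of those of a sampled profile with
slope between `m₁` and `m₂` and second and third derivatives bounded by `m₂`. -/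
structure IsRegularSteps (m₁ m₂ a : ℝ) (y : ℤ → ℝ) : Prop where
  lower : ∀ i, m₁ * a ≤ y (i + 1) - y i
  upper : ∀ i, y (i + 1) - y i ≤ m₂ * a
  second : ∀ i, |y (i + 1) - 2 * y i + y (i - 1)| ≤ m₂ * a ^ 2
  third : ∀ i, |y (i + 2) - 3 * y (i + 1) + 3 * y i - y (i - 1)| ≤ m₂ * a ^ 3

namespace IsRegularSteps

variable {m₁ m₂ a : ℝ} {y : ℤ → ℝ}

theorem le_add_nat (hy : IsRegularSteps m₁ m₂ a y) (k : ℕ) (i : ℤ) :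
    m₁ * (a * k) ≤ y (i + k) - y i := by
  have := mul_le_add_nat_sub hy.lower k i
  linarith

theorem add_nat_le (hy : IsRegularSteps m₁ m₂ a y) (k : ℕ) (i : ℤ) :
    y (i + k) - y i ≤ m₂ * (a * k) := by
  have := mul_le_add_nat_sub (u := fun i => -y i) (c := -(m₂ * a))
    (fun i => by linarith [hy.upper i]) k i
  linarith

theorem le_sub_nat (hy : IsRegularSteps m₁ m₂ a y) (k : ℕ) (i : ℤ) :
    m₁ * (a * k) ≤ y i - y (i - k) := by
  have := hy.le_add_nat k (i - k)
  rwa [sub_add_cancel] at this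

theorem sub_nat_le (hy : IsRegularSteps m₁ m₂ a y) (k : ℕ) (i : ℤ) :
    y i - y (i - k) ≤ m₂ * (a * k) := by
  have := hy.add_nat_le k (i - k)
  rwa [sub_add_cancel] at this

theorem abs_second_le (hy : IsRegularSteps m₁ m₂ a y) (k : ℕ) (i : ℤ) :
    |y (i + k) - 2 * y i + y (i - k)| ≤ m₂ * (a * k) ^ 2 := by
  have := abs_second_difference_le hy.second k i
  linarith

theorem abs_width_add_nat_sub_le (hy : IsRegularSteps m₁ m₂ a y) (k : ℕ) (i : ℤ) :
    |(y (i + k + 1) - y (i + k)) - (y (i + 1) - y i)| ≤ a * m₂ * (a * k) := by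
  have := abs_add_nat_sub_le (u := fun i => y (i + 1) - y i) (c := m₂ * a ^ 2)
    (fun i => by
      have := hy.second (i + 1)
      rw [add_sub_cancel_right] at this
      convert this using 2; ring) k i
  linarith

theorem abs_width_second_le (hy : IsRegularSteps m₁ m₂ a y) (k : ℕ) (i : ℤ) :
    |(y (i + k + 1) - y (i + k)) - 2 * (y (i + 1) - y i) + (y (i - k + 1) - y (i - k))| ≤
      a * m₂ * (a * k) ^ 2 := by
  have := abs_second_difference_le (u := fun i => y (i + 1) - y i) (c := m₂ * a ^ 3)
    (fun i => by
      have := hy.third i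
      rw [sub_add_cancel]
      rw [show i + 1 + 1 = i + 2 by ring]
      convert this using 2; ring) k i
  linarith

end IsRegularSteps

/-! ### Estimates for the interaction kernels -/

/-- The weight `a δ² / (s + δ)²` at `s = a (k + 1)` is at most the increment over `[s - a, s]` of the
function `δ s / (s + δ)`, which never exceeds `δ`; hence the sum telescopes. -/
theorem sum_weight_le {a δ : ℝ} (ha : 0 < a) (hδ : 0 < δ) (n : ℕ) :
    ∑ k ∈ Finset.range n, a * (δ ^ 2 / (a * ((k + 1 : ℕ) : ℝ) + δ) ^ 2) ≤ δ := by
  have key : ∑ k ∈ Finset.range n, a * (δ ^ 2 / (a * ((k + 1 : ℕ) : ℝ) + δ) ^ 2)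
      ≤ δ - δ ^ 2 / (a * n + δ) := by
    induction n with
    | zero => simp; field_simp; simp
    | succ n ih =>
      rw [Finset.sum_range_succ]
      have h1 : 0 < a * (n : ℝ) + δ := by positivity
      have h2 : 0 < a * ((n + 1 : ℕ) : ℝ) + δ := by positivity
      have h3 : δ ^ 2 / (a * n + δ) - δ ^ 2 / (a * ((n + 1 : ℕ) : ℝ) + δ)
          = a * (δ ^ 2 / ((a * n + δ) * (a * ((n + 1 : ℕ) : ℝ) + δ))) := by
        field_simp; push_cast; ring
      have h4 : a * (δ ^ 2 / (a * ((n + 1 : ℕ) : ℝ) + δ) ^ 2)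
          ≤ a * (δ ^ 2 / ((a * n + δ) * (a * ((n + 1 : ℕ) : ℝ) + δ))) := by
        rw [sq (a * ((n + 1 : ℕ) : ℝ) + δ)]
        gcongr
        simp
      linarith
  have : 0 ≤ δ ^ 2 / (a * n + δ) := by positivity
  linarith

theorem summable_weight {a δ : ℝ} (ha : 0 < a) (hδ : 0 < δ) :
    Summable fun k : ℕ => a * (δ ^ 2 / (a * ((k + 1 : ℕ) : ℝ) + δ) ^ 2) :=
  summable_of_sum_range_le (fun _ => by positivity) (sum_weight_le ha hδ)

theorem tsum_weight_le {a δ : ℝ} (ha : 0 < a) (hδ : 0 < δ) :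
    ∑' k : ℕ, a * (δ ^ 2 / (a * ((k + 1 : ℕ) : ℝ) + δ) ^ 2) ≤ δ :=
  (summable_weight ha hδ).tsum_le_of_sum_range_le (sum_weight_le ha hδ)

/-- A quantity bounded near the diagonal by `x` and at distance `s` by `y / s²` is bounded by the
summable weight with transition at `δ`. -/
theorem le_weight_of_le {τ x y s δ : ℝ} (hs : 0 < s) (hδ : 0 < δ) (hx : 0 ≤ x) (hy : 0 ≤ y)
    (h1 : s ≤ δ → τ ≤ x) (h2 : δ ≤ s → τ ≤ y / s ^ 2) :
    τ ≤ 4 * (x + y / δ ^ 2) * (δ ^ 2 / (s + δ) ^ 2) := by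
  rcases le_total s δ with h | h
  · have h3 : 1 ≤ 4 * (δ ^ 2 / (s + δ) ^ 2) := by
      rw [← mul_div_assoc, le_div_iff₀ (by positivity)]
      nlinarith
    have h4 : 0 ≤ y / δ ^ 2 := by positivity
    nlinarith [h1 h]
  · have h3 : y / s ^ 2 ≤ 4 * (y / δ ^ 2) * (δ ^ 2 / (s + δ) ^ 2) := by
      have : 4 * (y / δ ^ 2) * (δ ^ 2 / (s + δ) ^ 2) = 4 * y / (s + δ) ^ 2 := by
        field_simp
      rw [this, div_le_div_iff₀ (by positivity) (by positivity)]
      have : (s + δ) ^ 2 ≤ 4 * s ^ 2 := by nlinarith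
      nlinarith
    have h4 : 0 ≤ x * (δ ^ 2 / (s + δ) ^ 2) := by positivity
    nlinarith [h2 h]

theorem abs_inv_sq_sub_le {m₁ m₂ s P Q : ℝ} (hm₁ : 0 < m₁) (hs : 0 < s)
    (hP : m₁ * s ≤ P) (hP' : P ≤ m₂ * s) (hQ : m₁ * s ≤ Q) (hQ' : Q ≤ m₂ * s)
    (hPQ : |P - Q| ≤ m₂ * s ^ 2) :
    |1 / Q ^ 2 - 1 / P ^ 2| ≤ 2 * m₂ ^ 2 / m₁ ^ 4 / s := by
  have h0 : 0 < m₁ * s := by positivity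
  have p : 0 < P := h0.trans_le hP
  have q : 0 < Q := h0.trans_le hQ
  have e : 1 / Q ^ 2 - 1 / P ^ 2 = (P - Q) * (P + Q) / (P ^ 2 * Q ^ 2) := by
    field_simp; ring
  rw [e, abs_div, abs_mul, abs_of_pos (by positivity : 0 < P + Q),
    abs_of_pos (by positivity : 0 < P ^ 2 * Q ^ 2)]
  calc |P - Q| * (P + Q) / (P ^ 2 * Q ^ 2)
      ≤ (m₂ * s ^ 2) * (m₂ * s + m₂ * s) / ((m₁ * s) ^ 2 * (m₁ * s) ^ 2) := by
        have h1 : 0 ≤ m₂ * s ^ 2 := (abs_nonneg _).trans hPQ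
        have h2 : 0 ≤ m₂ * s := p.le.trans hP'
        have h3 : 0 ≤ m₂ * s ^ 2 * (m₂ * s + m₂ * s) := mul_nonneg h1 (add_nonneg h2 h2)
        gcongr
    _ = _ := by field_simp; ring

theorem abs_kernel_sub_kernel_le {m₁ m₂ s d E P Q P' Q' : ℝ} (hm₁ : 0 < m₁) (hs : 0 < s)
    (hd : 0 ≤ d)
    (hP : m₁ * s ≤ P) (hP2 : P ≤ m₂ * s) (hQ : m₁ * s ≤ Q)
    (hP' : m₁ * s ≤ P') (hQ' : m₁ * s ≤ Q') (hQ2' : Q' ≤ m₂ * s)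
    (hPP : |P' - P| ≤ d) (hQQ : |Q' - Q| ≤ d) (hE : |Q - P| ≤ E) {F : ℝ}
    (hF : |(Q' - P') - (Q - P)| ≤ F) :
    |(1 / P' - 1 / Q') - (1 / P - 1 / Q)| ≤
      F / (m₁ ^ 2 * s ^ 2) + E * (2 * (m₂ * s) * d) / (m₁ ^ 4 * s ^ 4) := by
  have h0 : 0 < m₁ * s := by positivity
  have p : 0 < P := h0.trans_le hP
  have q : 0 < Q := h0.trans_le hQ
  have p' : 0 < P' := h0.trans_le hP'
  have q' : 0 < Q' := h0.trans_le hQ'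
  have e : (1 / P' - 1 / Q') - (1 / P - 1 / Q)
      = ((Q' - P') - (Q - P)) / (P' * Q')
        + (Q - P) * (P * (Q - Q') + (P - P') * Q') / (P * Q * (P' * Q')) := by
    field_simp; ring
  have hE0 : 0 ≤ E := (abs_nonneg _).trans hE
  have hF0 : 0 ≤ F := (abs_nonneg _).trans hF
  have b1 : |((Q' - P') - (Q - P)) / (P' * Q')| ≤ F / ((m₁ * s) * (m₁ * s)) := by
    rw [abs_div, abs_of_pos (mul_pos p' q')]
    gcongr
  have b2 : |P * (Q - Q') + (P - P') * Q'| ≤ 2 * (m₂ * s) * d := by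
    refine (abs_add_le _ _).trans ?_
    rw [abs_mul, abs_mul, abs_of_pos p, abs_of_pos q', abs_sub_comm Q, abs_sub_comm P]
    have := mul_le_mul hP2 hQQ (abs_nonneg _) (p.le.trans hP2)
    have := mul_le_mul hPP hQ2' q'.le hd
    linarith
  have b3 : |(Q - P) * (P * (Q - Q') + (P - P') * Q') / (P * Q * (P' * Q'))|
      ≤ E * (2 * (m₂ * s) * d) / ((m₁ * s) * (m₁ * s) * ((m₁ * s) * (m₁ * s))) := by
    rw [abs_div, abs_mul, abs_of_pos (by positivity : 0 < P * Q * (P' * Q'))]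
    have h1 : 0 ≤ E * (2 * (m₂ * s) * d) := mul_nonneg hE0 ((abs_nonneg _).trans b2)
    gcongr
  rw [e]
  refine (abs_add_le _ _).trans ((add_le_add b1 b3).trans (le_of_eq ?_))
  ring

/-! ### The chemical potential -/

/-- The variation, from one step to the next, of the symmetric pair at distance `s = a k` in the
interaction sum of `stepM`: it is of order `a` near the diagonal and of order `a / s²` far away. -/
theorem abs_interaction_pair_add_one_sub_le {m₁ m₂ a : ℝ} {y : ℤ → ℝ} (hm₁ : 0 < m₁)
    (hm₂ : 0 < m₂) (ha : 0 < a) (hy : IsRegularSteps m₁ m₂ a y) (i : ℤ) (k : ℕ) (hk : 0 < k) :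
    |(1 / (y (i + 1 + k) - y (i + 1)) + 1 / (y (i + 1 - k) - y (i + 1)))
      - (1 / (y (i + k) - y i) + 1 / (y (i - k) - y i))| ≤
      4 * (2 * (a * (2 * m₂ / m₁ ^ 2 + 2 * m₂ ^ 3 / m₁ ^ 4))) * (1 / (a * k + 1) ^ 2) := by
  set s : ℝ := a * k with hs
  have hs0 : 0 < s := by positivity
  have hsum : ∀ i, 1 / (y (i + k) - y i) + 1 / (y (i - k) - y i)
      = 1 / (y (i + k) - y i) - 1 / (y i - y (i - k)) := by
    intro i
    rw [← neg_sub (y i) (y (i - k)), one_div_neg_eq_neg_one_div, ← sub_eq_add_neg]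
  rw [hsum, hsum]
  have bP : ∀ {F d E : ℝ}, (0 ≤ d) →
      (|(y (i + k + 1) - y (i + k)) - (y (i + 1) - y i)| ≤ d) →
      (|(y (i - k + 1) - y (i - k)) - (y (i + 1) - y i)| ≤ d) →
      |y (i + k) - 2 * y i + y (i - k)| ≤ E →
      |(y (i + k + 1) - y (i + k)) - 2 * (y (i + 1) - y i) + (y (i - k + 1) - y (i - k))| ≤ F →
      |1 / (y (i + 1 + k) - y (i + 1)) - 1 / (y (i + 1) - y (i + 1 - k))
        - (1 / (y (i + k) - y i) - 1 / (y i - y (i - k)))| ≤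
        F / (m₁ ^ 2 * s ^ 2) + E * (2 * (m₂ * s) * d) / (m₁ ^ 4 * s ^ 4) := by
    intro F d E hd h1 h2 h3 h4
    refine abs_kernel_sub_kernel_le (P := y (i + k) - y i) (Q := y i - y (i - k))
      (P' := y (i + 1 + k) - y (i + 1)) (Q' := y (i + 1) - y (i + 1 - k)) (E := E) (F := F)
      (d := d) hm₁ hs0 hd (hy.le_add_nat k i) (hy.add_nat_le k i) (hy.le_sub_nat k i)
      (hy.le_add_nat k _) (hy.le_sub_nat k _) (hy.sub_nat_le k _) ?_ ?_ ?_ ?_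
    · rw [add_right_comm]; convert h1 using 2; ring
    · rw [add_sub_right_comm, abs_sub_comm]; convert h2 using 2; ring
    · rw [abs_sub_comm]; convert h3 using 2; ring
    · rw [add_sub_right_comm, add_right_comm, abs_sub_comm]; convert h4 using 2; ring
  have d1 := hy.abs_width_add_nat_sub_le k i
  have d2 : |(y (i - k + 1) - y (i - k)) - (y (i + 1) - y i)| ≤ a * m₂ * (a * k) := by
    have := hy.abs_width_add_nat_sub_le k (i - k)
    rw [sub_add_cancel] at this
    rwa [abs_sub_comm]
  have d3 := hy.abs_second_le k i
  have d4 := hy.abs_width_second_le k i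
  have hC1 : 0 ≤ 2 * m₂ / m₁ ^ 2 := by positivity
  have hC2 : 0 ≤ 2 * m₂ ^ 3 / m₁ ^ 4 := by positivity
  have := le_weight_of_le (τ := |1 / (y (i + 1 + k) - y (i + 1)) - 1 / (y (i + 1) - y (i + 1 - k))
      - (1 / (y (i + k) - y i) - 1 / (y i - y (i - k)))|) (s := s) (δ := 1)
      (x := a * (2 * m₂ / m₁ ^ 2 + 2 * m₂ ^ 3 / m₁ ^ 4))
      (y := a * (2 * m₂ / m₁ ^ 2 + 2 * m₂ ^ 3 / m₁ ^ 4)) hs0 one_pos (by positivity)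
      (by positivity) ?_ ?_
  · refine this.trans (le_of_eq ?_)
    simp only [one_pow, div_one]; ring
  · intro _
    refine (bP (by positivity) d1 d2 d3 d4).trans (le_of_sub_nonneg ?_)
    have : a * (2 * m₂ / m₁ ^ 2 + 2 * m₂ ^ 3 / m₁ ^ 4) - (a * m₂ * s ^ 2 / (m₁ ^ 2 * s ^ 2)
        + m₂ * s ^ 2 * (2 * (m₂ * s) * (a * m₂ * s)) / (m₁ ^ 4 * s ^ 4)) = a * m₂ / m₁ ^ 2 := by
      field_simp; ring
    rw [this]; positivity
  · intro _
    have b : ∀ u v : ℝ, 0 ≤ u → u ≤ a * m₂ → 0 ≤ v → v ≤ a * m₂ → |u - v| ≤ a * m₂ := by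
      intro u v h1 h2 h3 h4
      rw [abs_le]; constructor <;> linarith
    have p : ∀ i, 0 ≤ y (i + 1) - y i := fun i => by
      have := hy.lower i
      have : 0 < m₁ * a := by positivity
      linarith
    have q : ∀ i, y (i + 1) - y i ≤ a * m₂ := fun i => by linarith [hy.upper i]
    have d1 := b _ _ (p (i + k)) (q _) (p i) (q _)
    have d2 := b _ _ (p (i - k)) (q _) (p i) (q _)
    have d3 : |y (i + k) - 2 * y i + y (i - k)| ≤ m₂ * s := by
      have := hy.add_nat_le k i
      have := hy.sub_nat_le k i
      have := hy.le_add_nat k i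
      have := hy.le_sub_nat k i
      have : 0 < m₁ * s := by positivity
      rw [abs_le]; constructor <;> linarith
    have d4 : |(y (i + k + 1) - y (i + k)) - 2 * (y (i + 1) - y i)
        + (y (i - k + 1) - y (i - k))| ≤ 2 * (a * m₂) := by
      have := p (i + k); have := p (i - k); have := p i
      have := q (i + k); have := q (i - k); have := q i
      rw [abs_le]; constructor <;> linarith
    refine (bP (by positivity) d1 d2 d3 d4).trans (le_of_eq ?_)
    field_simp

theorem IsRegularSteps.le_period {m₁ m₂ L : ℝ} {N : ℕ} {y : ℤ → ℝ}
    (hN : 0 < N) (hy : IsRegularSteps m₁ m₂ (1 / (N : ℝ)) y) (hL : ∀ i, y (i + N) = y i + L) :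
    m₁ ≤ L := by
  have h := hy.le_add_nat N 0
  rw [hL, one_div_mul_cancel (by positivity)] at h
  linarith

/-- The second difference of a quasi-periodic step sequence is periodic in the step, so it stays
bounded at large distances. -/
theorem IsRegularSteps.abs_second_le_of_period {m₁ m₂ L : ℝ} {N : ℕ} {y : ℤ → ℝ}
    (hN : 0 < N) (hy : IsRegularSteps m₁ m₂ (1 / (N : ℝ)) y) (hL : ∀ i, y (i + N) = y i + L)
    (k : ℕ) (i : ℤ) : |y (i + k) - 2 * y i + y (i - k)| ≤ m₂ := by
  have hper : Function.Periodic (fun k : ℕ => y (i + k) - 2 * y i + y (i - k)) N := by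
    intro k
    have h1 := hL (i + k)
    have h2 := hL (i - (k + N : ℕ))
    have e1 : i + ((k + N : ℕ) : ℤ) = i + k + N := by push_cast; ring
    have e2 : i - ((k + N : ℕ) : ℤ) + N = i - k := by push_cast; ring
    rw [e2] at h2
    simp only [e1]
    linarith
  rw [← hper.map_mod_nat k]
  have hN' : (0 : ℝ) < N := by positivity
  have hm₂ : 0 ≤ m₂ := nonneg_of_mul_nonneg_left
    ((abs_nonneg _).trans (hy.second 0)) (by positivity)
  have hr : 1 / (N : ℝ) * ((k % N : ℕ) : ℝ) ≤ 1 := by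
    rw [one_div_mul_eq_div, div_le_one hN']
    exact_mod_cast (Nat.mod_lt k hN).le
  refine (hy.abs_second_le _ i).trans (mul_le_of_le_one_right hm₂ ?_)
  exact pow_le_one₀ (by positivity) hr

theorem abs_interaction_pair_le {m₁ m₂ L : ℝ} {N : ℕ} {y : ℤ → ℝ} (hm₁ : 0 < m₁) (hm₂ : 0 < m₂)
    (hN : 0 < N) (hy : IsRegularSteps m₁ m₂ (1 / (N : ℝ)) y) (hL : ∀ i, y (i + N) = y i + L)
    (i : ℤ) (k : ℕ) (hk : 0 < k) :
    |1 / (y (i + k) - y i) + 1 / (y (i - k) - y i)| ≤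
      8 * m₂ / m₁ ^ 2 * (1 / (1 / (N : ℝ) * k + 1) ^ 2) := by
  have hN' : (0 : ℝ) < N := by positivity
  have hs0 : 0 < 1 / (N : ℝ) * k := by positivity
  have hP := hy.le_add_nat k i
  have hQ := hy.le_sub_nat k i
  have d1 := hy.abs_second_le k i
  have d2 := hy.abs_second_le_of_period hN hL k i
  revert hP hQ d1 d2 hs0
  generalize 1 / (N : ℝ) * k = s
  intro hs0 hP hQ d1 d2
  have h0 : 0 < m₁ * s := by positivity
  have p := h0.trans_le hP
  have q := h0.trans_le hQ
  have e : 1 / (y (i + k) - y i) + 1 / (y (i - k) - y i)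
      = -(y (i + k) - 2 * y i + y (i - k)) / ((y (i + k) - y i) * (y i - y (i - k))) := by
    rw [← neg_sub (y i) (y (i - k)), one_div_neg_eq_neg_one_div]
    field_simp; ring
  have b : ∀ {c : ℝ}, |y (i + k) - 2 * y i + y (i - k)| ≤ c →
      |1 / (y (i + k) - y i) + 1 / (y (i - k) - y i)| ≤ c / ((m₁ * s) * (m₁ * s)) := by
    intro c hc
    have : 0 ≤ c := (abs_nonneg _).trans hc
    rw [e, abs_div, abs_neg, abs_of_pos (mul_pos p q)]
    gcongr
  refine (le_weight_of_le (x := m₂ / m₁ ^ 2) (y := m₂ / m₁ ^ 2) hs0 one_pos (by positivity)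
    (by positivity) (fun _ => (b d1).trans (le_of_eq ?_))
    (fun _ => (b d2).trans (le_of_eq ?_))).trans (le_of_eq ?_)
  · field_simp
  · field_simp
  · simp only [one_pow, div_one]; ring

theorem symSum_interaction (a : ℝ) (y : ℤ → ℝ) (i : ℤ) :
    symSum (fun j => a / (y j - y i)) i = ∑' k : ℕ, a * (1 / (y (i + (k + 1 : ℕ)) - y i)
      + 1 / (y (i - (k + 1 : ℕ)) - y i)) := by
  unfold symSum
  refine tsum_congr fun k => ?_
  push_cast
  ring

theorem summable_interaction {m₁ m₂ L : ℝ} {N : ℕ} {y : ℤ → ℝ} (hm₁ : 0 < m₁) (hm₂ : 0 < m₂)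
    (hN : 0 < N) (hy : IsRegularSteps m₁ m₂ (1 / (N : ℝ)) y) (hL : ∀ i, y (i + N) = y i + L)
    (i : ℤ) :
    Summable fun k : ℕ => 1 / (N : ℝ) * (1 / (y (i + (k + 1 : ℕ)) - y i)
      + 1 / (y (i - (k + 1 : ℕ)) - y i)) := by
  have ha : 0 < 1 / (N : ℝ) := by positivity
  refine Summable.of_norm_bounded ((summable_weight ha one_pos).mul_left (8 * m₂ / m₁ ^ 2)) ?_
  intro k
  have := abs_interaction_pair_le hm₁ hm₂ hN hy hL i (k + 1) k.succ_pos
  rw [Real.norm_eq_abs, abs_mul, abs_of_pos ha, one_pow]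
  calc _ ≤ 1 / (N : ℝ) * _ := mul_le_mul_of_nonneg_left this ha.le
    _ = _ := by ring

theorem abs_symSum_interaction_sub_le {m₁ m₂ L : ℝ} {N : ℕ} {y : ℤ → ℝ} (hm₁ : 0 < m₁)
    (hm₂ : 0 < m₂) (hN : 0 < N) (hy : IsRegularSteps m₁ m₂ (1 / (N : ℝ)) y)
    (hL : ∀ i, y (i + N) = y i + L) (i : ℤ) :
    |symSum (fun j => 1 / (N : ℝ) / (y j - y (i + 1))) (i + 1)
      - symSum (fun j => 1 / (N : ℝ) / (y j - y i)) i| ≤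
      8 * (2 * m₂ / m₁ ^ 2 + 2 * m₂ ^ 3 / m₁ ^ 4) * (1 / (N : ℝ)) := by
  have ha : 0 < 1 / (N : ℝ) := by positivity
  have s1 := summable_interaction hm₁ hm₂ hN hy hL (i + 1)
  have s0 := summable_interaction hm₁ hm₂ hN hy hL i
  rw [symSum_interaction, symSum_interaction, ← s1.tsum_sub s0]
  have hw := (summable_weight ha one_pos).mul_left
    (8 * (2 * m₂ / m₁ ^ 2 + 2 * m₂ ^ 3 / m₁ ^ 4) * (1 / (N : ℝ)))
  rw [← Real.norm_eq_abs]
  refine (tsum_of_norm_bounded hw.hasSum (fun k => ?_)).trans ?_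
  · have := abs_interaction_pair_add_one_sub_le hm₁ hm₂ ha hy i (k + 1) k.succ_pos
    rw [← mul_sub, Real.norm_eq_abs, abs_mul, abs_of_pos ha, one_pow]
    calc _ ≤ 1 / (N : ℝ) * _ := mul_le_mul_of_nonneg_left this ha.le
      _ = _ := by ring
  · rw [tsum_mul_left]
    exact mul_le_of_le_one_right (by positivity) (tsum_weight_le ha one_pos)

/-- The scaled step widths `h_i = (y_{i+1} - y_i) / a`. -/
noncomputable def stepWidth (a : ℝ) (y : ℤ → ℝ) (i : ℤ) : ℝ := (y (i + 1) - y i) / a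

theorem IsRegularSteps.le_stepWidth {m₁ m₂ a : ℝ} {y : ℤ → ℝ} (ha : 0 < a)
    (hy : IsRegularSteps m₁ m₂ a y) (i : ℤ) : m₁ ≤ stepWidth a y i :=
  (le_div_iff₀ ha).2 (hy.lower i)

theorem IsRegularSteps.stepWidth_le {m₁ m₂ a : ℝ} {y : ℤ → ℝ} (ha : 0 < a)
    (hy : IsRegularSteps m₁ m₂ a y) (i : ℤ) : stepWidth a y i ≤ m₂ :=
  (div_le_iff₀ ha).2 (hy.upper i)

theorem IsRegularSteps.discreteC2_one_div {m₁ m₂ a : ℝ} {y : ℤ → ℝ} (hm₁ : 0 < m₁) (ha : 0 < a)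
    (hy : IsRegularSteps m₁ m₂ a y) :
    DiscreteC2 a (1 / m₁ + m₂ / m₁ ^ 2 + 2 * m₂ ^ 2 / m₁ ^ 3)
      (fun i => 1 / stepWidth a y i) := by
  refine DiscreteC2.one_div ha hm₁ (hy.le_stepWidth ha) (fun i => ?_) (fun i => ?_)
  · have h := hy.second (i + 1)
    rw [add_sub_cancel_right] at h
    have e : stepWidth a y (i + 1) - stepWidth a y i
        = (y (i + 1 + 1) - 2 * y (i + 1) + y i) / a := by
      unfold stepWidth; ring
    rw [e, abs_div, abs_of_pos ha, div_le_iff₀ ha]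
    linarith
  · have h := hy.third i
    have e : stepWidth a y (i + 1) - 2 * stepWidth a y i + stepWidth a y (i - 1)
        = (y (i + 2) - 3 * y (i + 1) + 3 * y i - y (i - 1)) / a := by
      unfold stepWidth
      rw [sub_add_cancel, add_assoc]; norm_num; ring
    rw [e, abs_div, abs_of_pos ha, div_le_iff₀ ha]
    linarith

/-- The chemical potential of regular steps is Lipschitz, uniformly in the mesh size. -/
theorem exists_abs_stepM_sub_le {m₁ m₂ : ℝ} (hm₁ : 0 < m₁) (hm₂ : 0 < m₂) :
    ∃ C, 0 ≤ C ∧ ∀ (N : ℕ) (L : ℝ) (y : ℤ → ℝ), 0 < N →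
      IsRegularSteps m₁ m₂ (1 / (N : ℝ)) y → (∀ i, y (i + N) = y i + L) →
      ∀ i, |stepM L (1 / (N : ℝ)) y (i + 1) - stepM L (1 / (N : ℝ)) y i| ≤ C * (1 / (N : ℝ)) := by
  set c := 1 / m₁ + m₂ / m₁ ^ 2 + 2 * m₂ ^ 2 / m₁ ^ 3
  have hc : 0 ≤ c := by positivity
  set d := 8 * (2 * m₂ / m₁ ^ 2 + 2 * m₂ ^ 3 / m₁ ^ 4)
  have hd : 0 ≤ d := by positivity
  refine ⟨(c + 4 * (c * (4 * (c * c)))) + 2 / m₁ * d, by positivity, ?_⟩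
  intro N L y hN hy hL i
  have ha : 0 < 1 / (N : ℝ) := by positivity
  have hLm := hy.le_period hN hL
  have hL0 : 0 < L := hm₁.trans_le hLm
  have hloc := abs_symSum_interaction_sub_le hm₁ hm₂ hN hy hL i
  revert ha hloc hy
  generalize 1 / (N : ℝ) = a
  intro hy ha hloc
  have hr := hy.discreteC2_one_div hm₁ ha
  obtain ⟨q, hqdef⟩ : ∃ q : ℤ → ℝ, ∀ i, 1 / stepWidth a y i + 1 / stepWidth a y i
      * (1 / stepWidth a y i * (1 / stepWidth a y i)) = q i := ⟨_, fun _ => rfl⟩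
  have hq := (hr.add (hr.mul ha.le (hr.mul ha.le hr))).second i
  simp only [hqdef] at hq
  have hne : ∀ i, y (i + 1) - y i ≠ 0 := fun i => by
    have := hy.lower i
    have : 0 < m₁ * a := by positivity
    linarith
  -- The local part of `M` is a difference of `q / a`, so its difference is a second difference.
  have hF : ∀ i, 1 / (y (i + 1) - y i) + a ^ 2 / (y (i + 1) - y i) ^ 3
      = q i / a := by
    intro i
    have := hne i
    rw [← hqdef]
    unfold stepWidth
    field_simp
  have hF' := hF (i - 1)
  rw [sub_add_cancel] at hF'
  have e : stepM L a y (i + 1) - stepM L a y i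
      = ((1 / (y (i + 1 + 1) - y (i + 1)) + a ^ 2 / (y (i + 1 + 1) - y (i + 1)) ^ 3)
        - 2 * (1 / (y (i + 1) - y i) + a ^ 2 / (y (i + 1) - y i) ^ 3)
        + (1 / (y i - y (i - 1)) + a ^ 2 / (y i - y (i - 1)) ^ 3))
        - 2 / L * (symSum (fun j => a / (y j - y (i + 1))) (i + 1)
          - symSum (fun j => a / (y j - y i)) i) := by
    unfold stepM
    rw [add_sub_cancel_right]; ring
  rw [e, hF, hF, hF', ← mul_div_assoc 2 (q i), ← sub_div, ← add_div]
  refine (abs_sub _ _).trans ?_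
  rw [abs_div, abs_of_pos ha, abs_mul, abs_of_nonneg (by positivity : 0 ≤ 2 / L), add_mul]
  refine add_le_add ?_ ?_
  · rw [div_le_iff₀ ha]
    linarith
  · rw [mul_assoc]
    gcongr

/-! ### The linearized interaction -/

/-- The forward difference quotient of `z` with mesh size `a`. -/
noncomputable def diffQuot (a : ℝ) (z : ℤ → ℝ) (i : ℤ) : ℝ := (z (i + 1) - z i) / a

/-- The centered second difference quotient of `z` with mesh size `a`. -/
noncomputable def diffQuot₂ (a : ℝ) (z : ℤ → ℝ) (i : ℤ) : ℝ :=
  (z (i + 1) - 2 * z i + z (i - 1)) / a ^ 2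

/-- The symmetric pair at distance `k` in the linearized interaction sum. -/
noncomputable def linPair (y z : ℤ → ℝ) (k : ℕ) (i : ℤ) : ℝ :=
  (z (i + k) - z i) / (y (i + k) - y i) ^ 2 + (z (i - k) - z i) / (y (i - k) - y i) ^ 2

/-- Away from the diagonal, the decay of the kernel alone bounds the pair by `z` itself. -/
theorem ellTwoNorm_linPair_le_far {m₁ m₂ : ℝ} {N : ℕ} {y z : ℤ → ℝ} (hm₁ : 0 < m₁)
    (hN : 0 < N) (hy : IsRegularSteps m₁ m₂ (1 / (N : ℝ)) y) (hz : ∀ i, z (i + N) = z i)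
    (k : ℕ) (hk : 0 < k) :
    ellTwoNorm N (linPair y z k) ≤
      4 / m₁ ^ 2 * ellTwoNorm N z / (1 / (N : ℝ) * k) ^ 2 := by
  have hN' : (0 : ℝ) < N := by positivity
  have hs0 : 0 < 1 / (N : ℝ) * k := by positivity
  have hP := hy.le_add_nat k
  have hQ := hy.le_sub_nat k
  revert hs0 hP hQ
  generalize 1 / (N : ℝ) * k = s
  intro hs0 hP hQ
  have h0 : 0 < m₁ * s := by positivity
  have h1 : ellTwoNorm N (fun i => (z (i + k) - z i) / (y (i + k) - y i) ^ 2)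
      ≤ 1 / (m₁ * s) ^ 2 * ellTwoNorm N (fun i => z (i + k) - z i) := by
    refine ellTwoNorm_le_mul_of_abs_le (by positivity) fun i => ?_
    have p := h0.trans_le (hP i)
    rw [abs_div, abs_of_pos (by positivity : 0 < (y (i + k) - y i) ^ 2), one_div_mul_eq_div]
    gcongr
    exact hP i
  have h2 : ellTwoNorm N (fun i => (z (i - k) - z i) / (y (i - k) - y i) ^ 2)
      ≤ 1 / (m₁ * s) ^ 2 * ellTwoNorm N (fun i => z (i - k) - z i) := by
    refine ellTwoNorm_le_mul_of_abs_le (by positivity) fun i => ?_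
    have p := h0.trans_le (hQ i)
    rw [abs_div, ← neg_sub (y i), neg_sq,
      abs_of_pos (by positivity : 0 < (y i - y (i - k)) ^ 2), one_div_mul_eq_div]
    gcongr
    exact hQ i
  have hneg : ellTwoNorm N (fun i => -z i) = ellTwoNorm N z := by simp [ellTwoNorm]
  have h3 := ellTwoNorm_add_le N (fun i => z (i + k)) (fun i => -z i)
  have h4 := ellTwoNorm_add_le N (fun i => z (i - k)) (fun i => -z i)
  rw [hneg, ellTwoNorm_add_nat hz] at h3
  rw [hneg, ellTwoNorm_sub_nat hz] at h4
  simp only [← sub_eq_add_neg] at h3 h4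
  have h5 : 0 ≤ 1 / (m₁ * s) ^ 2 := by positivity
  calc ellTwoNorm N (linPair y z k) ≤ _ := ellTwoNorm_add_le _ _ _
    _ ≤ 1 / (m₁ * s) ^ 2 * (ellTwoNorm N z + ellTwoNorm N z)
        + 1 / (m₁ * s) ^ 2 * (ellTwoNorm N z + ellTwoNorm N z) :=
      add_le_add (h1.trans (by gcongr)) (h2.trans (by gcongr))
    _ = _ := by field_simp; ring

/-- Near the diagonal, a second difference of `z` compensates the double pole of the kernel, and
the asymmetry of the kernel leaves a simple pole against a first difference. -/
theorem ellTwoNorm_linPair_le_near {m₁ m₂ : ℝ} {N : ℕ} {y z : ℤ → ℝ} (hm₁ : 0 < m₁)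
    (hN : 0 < N) (hy : IsRegularSteps m₁ m₂ (1 / (N : ℝ)) y) (hz : ∀ i, z (i + N) = z i)
    (k : ℕ) (hk : 0 < k) :
    ellTwoNorm N (linPair y z k) ≤
      1 / m₁ ^ 2 * ellTwoNorm N (diffQuot₂ (1 / (N : ℝ)) z)
        + 2 * m₂ ^ 2 / m₁ ^ 4 * ellTwoNorm N (diffQuot (1 / (N : ℝ)) z) := by
  have hN' : (0 : ℝ) < N := by positivity
  have ha : 0 < 1 / (N : ℝ) := by positivity
  have g1 : ellTwoNorm N (fun i => z (i - k) - z i)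
      ≤ 1 / (N : ℝ) * k * ellTwoNorm N (diffQuot (1 / (N : ℝ)) z) := by
    have e : ellTwoNorm N (fun i => z (i + 1) - z i)
        ≤ 1 / (N : ℝ) * ellTwoNorm N (diffQuot (1 / (N : ℝ)) z) :=
      ellTwoNorm_le_mul_of_abs_le ha.le fun i => by
        unfold diffQuot
        rw [abs_div, abs_of_pos ha, mul_div_cancel₀ _ ha.ne']
    have := ellTwoNorm_sub_nat_sub_le hz k
    have : (k : ℝ) * ellTwoNorm N (fun i => z (i + 1) - z i)
        ≤ k * (1 / (N : ℝ) * ellTwoNorm N (diffQuot (1 / (N : ℝ)) z)) := by gcongr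
    linarith
  have g2 : ellTwoNorm N (fun i => z (i + k) - 2 * z i + z (i - k))
      ≤ (1 / (N : ℝ) * k) ^ 2 * ellTwoNorm N (diffQuot₂ (1 / (N : ℝ)) z) := by
    have e : ellTwoNorm N (fun i => z (i + 1) - 2 * z i + z (i - 1))
        ≤ (1 / (N : ℝ)) ^ 2 * ellTwoNorm N (diffQuot₂ (1 / (N : ℝ)) z) :=
      ellTwoNorm_le_mul_of_abs_le (by positivity) fun i => by
        unfold diffQuot₂
        rw [abs_div, abs_of_pos (by positivity : 0 < (1 / (N : ℝ)) ^ 2),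
          mul_div_cancel₀ _ (by positivity)]
    have := ellTwoNorm_second_difference_le hz k
    have : (k : ℝ) ^ 2 * ellTwoNorm N (fun i => z (i + 1) - 2 * z i + z (i - 1))
        ≤ (k : ℝ) ^ 2 * ((1 / (N : ℝ)) ^ 2 * ellTwoNorm N (diffQuot₂ (1 / (N : ℝ)) z)) := by
      gcongr
    linarith
  have hs0 : 0 < 1 / (N : ℝ) * k := by positivity
  have hP := hy.le_add_nat k
  have hQ := hy.le_sub_nat k
  have hP2 := hy.add_nat_le k
  have hQ2 := hy.sub_nat_le k
  have hPQ := hy.abs_second_le k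
  revert hs0 hP hQ hP2 hQ2 hPQ g1 g2
  generalize 1 / (N : ℝ) * k = s
  intro g1 g2 hs0 hP hQ hP2 hQ2 hPQ
  have h0 : 0 < m₁ * s := by positivity
  have h1 : ellTwoNorm N (fun i => (z (i + k) - 2 * z i + z (i - k)) / (y (i + k) - y i) ^ 2)
      ≤ 1 / (m₁ * s) ^ 2 * ellTwoNorm N (fun i => z (i + k) - 2 * z i + z (i - k)) := by
    refine ellTwoNorm_le_mul_of_abs_le (by positivity) fun i => ?_
    have p := h0.trans_le (hP i)
    rw [abs_div, abs_of_pos (by positivity : 0 < (y (i + k) - y i) ^ 2), one_div_mul_eq_div]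
    gcongr
    exact hP i
  have h2 : ellTwoNorm N (fun i => (z (i - k) - z i)
        * (1 / (y i - y (i - k)) ^ 2 - 1 / (y (i + k) - y i) ^ 2))
      ≤ 2 * m₂ ^ 2 / m₁ ^ 4 / s * ellTwoNorm N (fun i => z (i - k) - z i) := by
    refine ellTwoNorm_le_mul_of_abs_le (by positivity) fun i => ?_
    rw [abs_mul, mul_comm]
    refine mul_le_mul_of_nonneg_right ?_ (abs_nonneg _)
    refine abs_inv_sq_sub_le hm₁ hs0 (hP i) (hP2 i) (hQ i) (hQ2 i) ?_
    convert hPQ i using 2; ring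
  have e : linPair y z k = fun i =>
      (z (i + k) - 2 * z i + z (i - k)) / (y (i + k) - y i) ^ 2
        + (z (i - k) - z i) * (1 / (y i - y (i - k)) ^ 2 - 1 / (y (i + k) - y i) ^ 2) := by
    ext i
    unfold linPair
    rw [← neg_sub (y i) (y (i - k)), neg_sq]
    ring
  rw [e]
  calc _ ≤ _ := ellTwoNorm_add_le _ _ _
    _ ≤ 1 / (m₁ * s) ^ 2 * (s ^ 2 * ellTwoNorm N (diffQuot₂ (1 / (N : ℝ)) z))
        + 2 * m₂ ^ 2 / m₁ ^ 4 / s * (s * ellTwoNorm N (diffQuot (1 / (N : ℝ)) z)) :=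
      add_le_add (h1.trans (by gcongr)) (h2.trans (by gcongr))
    _ = _ := by field_simp

theorem abs_le_sqrt_mul_ellTwoNorm {N : ℕ} (u : ℤ → ℝ) {i : ℤ}
    (hi : i ∈ Finset.Icc (1 : ℤ) N) : |u i| ≤ √N * ellTwoNorm N u := by
  have hN : (0 : ℝ) < N := by
    simp only [Finset.mem_Icc] at hi
    exact_mod_cast (by omega : (0 : ℤ) < N)
  refine abs_le_of_sq_le_sq ?_ (mul_nonneg (Real.sqrt_nonneg _) (ellTwoNorm_nonneg _ _))
  rw [mul_pow, Real.sq_sqrt hN.le, ellTwoNorm_sq]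
  have := Finset.single_le_sum (f := fun i => 1 / (N : ℝ) * u i ^ 2)
    (fun _ _ => by positivity) hi
  calc u i ^ 2 = N * (1 / (N : ℝ) * u i ^ 2) := by field_simp
    _ ≤ _ := by gcongr

/-- Minkowski's inequality for series. -/
theorem ellTwoNorm_tsum_le {N : ℕ} {u : ℕ → ℤ → ℝ} {τ : ℕ → ℝ} {c : ℝ}
    (hu : ∀ k, ellTwoNorm N (u k) ≤ τ k) (hτ : ∀ n, ∑ k ∈ Finset.range n, τ k ≤ c) :
    ellTwoNorm N (fun i => ∑' k, u k i) ≤ c := by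
  have hs : Summable τ :=
    summable_of_sum_range_le (fun k => (ellTwoNorm_nonneg _ _).trans (hu k)) hτ
  have hlim : Tendsto (fun n => ellTwoNorm N (fun i => ∑ k ∈ Finset.range n, u k i)) atTop
      (𝓝 (ellTwoNorm N (fun i => ∑' k, u k i))) := by
    refine (Real.continuous_sqrt.tendsto _).comp (tendsto_finsetSum _ fun i hi => ?_)
    refine Tendsto.const_mul _ (Tendsto.pow ?_ 2)
    refine (Summable.of_norm_bounded (hs.mul_left √N) fun k => ?_).hasSum.tendsto_sum_nat
    exact (abs_le_sqrt_mul_ellTwoNorm (u k) hi).trans (by gcongr; exact hu k)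
  refine le_of_tendsto' hlim fun n => ?_
  exact (ellTwoNorm_sum_le N n u).trans ((Finset.sum_le_sum fun k _ => hu k).trans (hτ n))

theorem symSum_linearized (a : ℝ) (y z : ℤ → ℝ) (i : ℤ) :
    symSum (fun j => a * (z j - z i) / (y j - y i) ^ 2) i
      = ∑' k : ℕ, a * linPair y z (k + 1) i := by
  unfold symSum linPair
  refine tsum_congr fun k => ?_
  push_cast
  ring

/-- The linearized interaction is of lower order than the second difference: its norm is bounded
by an arbitrarily small multiple of the norms of the difference quotients, plus a multiple of the
norm of `z`. -/
theorem ellTwoNorm_symSum_linearized_le {m₁ m₂ δ : ℝ} {N : ℕ} {y z : ℤ → ℝ} (hm₁ : 0 < m₁)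
    (hδ : 0 < δ) (hN : 0 < N) (hy : IsRegularSteps m₁ m₂ (1 / (N : ℝ)) y)
    (hz : ∀ i, z (i + N) = z i) :
    ellTwoNorm N (fun i => symSum (fun j => 1 / (N : ℝ) * (z j - z i) / (y j - y i) ^ 2) i) ≤
      4 * (δ * (1 / m₁ ^ 2 * ellTwoNorm N (diffQuot₂ (1 / (N : ℝ)) z)
        + 2 * m₂ ^ 2 / m₁ ^ 4 * ellTwoNorm N (diffQuot (1 / (N : ℝ)) z))
        + 4 / m₁ ^ 2 * ellTwoNorm N z / δ) := by
  have ha : 0 < 1 / (N : ℝ) := by positivity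
  have hW := ellTwoNorm_nonneg N (diffQuot₂ (1 / (N : ℝ)) z)
  have hV := ellTwoNorm_nonneg N (diffQuot (1 / (N : ℝ)) z)
  have hZ := ellTwoNorm_nonneg N z
  simp only [symSum_linearized]
  set X := 1 / m₁ ^ 2 * ellTwoNorm N (diffQuot₂ (1 / (N : ℝ)) z)
        + 2 * m₂ ^ 2 / m₁ ^ 4 * ellTwoNorm N (diffQuot (1 / (N : ℝ)) z) with hX
  set Y := 4 / m₁ ^ 2 * ellTwoNorm N z with hY
  have hX0 : 0 ≤ X := by positivity
  have hY0 : 0 ≤ Y := by positivity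
  refine ellTwoNorm_tsum_le (τ := fun k => 4 * (X + Y / δ ^ 2) *
    (1 / (N : ℝ) * (δ ^ 2 / (1 / (N : ℝ) * ((k + 1 : ℕ) : ℝ) + δ) ^ 2))) (fun k => ?_)
    (fun n => ?_)
  · have h := le_weight_of_le (τ := ellTwoNorm N (linPair y z (k + 1))) (x := X) (y := Y)
      (s := 1 / (N : ℝ) * ((k + 1 : ℕ) : ℝ)) (by positivity) hδ hX0 hY0
      (fun _ => ellTwoNorm_linPair_le_near hm₁ hN hy hz (k + 1) k.succ_pos)
      (fun _ => ellTwoNorm_linPair_le_far hm₁ hN hy hz (k + 1) k.succ_pos)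
    calc _ ≤ 1 / (N : ℝ) * ellTwoNorm N (linPair y z (k + 1)) :=
          ellTwoNorm_le_mul_of_abs_le ha.le fun i => by rw [abs_mul, abs_of_pos ha]
      _ ≤ 1 / (N : ℝ) * _ := mul_le_mul_of_nonneg_left h ha.le
      _ = _ := by ring
  · rw [← Finset.mul_sum]
    calc _ ≤ 4 * (X + Y / δ ^ 2) * δ :=
          mul_le_mul_of_nonneg_left (sum_weight_le ha hδ n) (by positivity)
      _ = _ := by field_simp

/-! ### The energy estimate -/

/-- Summation by parts over one period. -/
theorem sum_mul_sub_eq {N : ℕ} {z F : ℤ → ℝ} (hz : ∀ i, z (i + N) = z i)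
    (hF : ∀ i, F (i + N) = F i) :
    ∑ i ∈ Finset.Icc (1 : ℤ) N, z i * (F i - F (i - 1))
      = -∑ i ∈ Finset.Icc (1 : ℤ) N, (z (i + 1) - z i) * F i := by
  have h := sum_period_add_one (N := N) (u := fun i => z i * F (i - 1))
    (fun i => by rw [hz, add_sub_right_comm, hF])
  simp only [add_sub_cancel_right] at h
  simp only [mul_sub, sub_mul, Finset.sum_sub_distrib]
  linarith

/-- Interpolation of the first difference quotient between `z` and the second one. -/
theorem ellTwoNorm_diffQuot_sq_le {N : ℕ} {z : ℤ → ℝ} (hN : 0 < N)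
    (hz : ∀ i, z (i + N) = z i) :
    ellTwoNorm N (diffQuot (1 / (N : ℝ)) z) ^ 2 ≤
      ellTwoNorm N z * ellTwoNorm N (diffQuot₂ (1 / (N : ℝ)) z) := by
  have hv : ∀ i, diffQuot (1 / (N : ℝ)) z (i + N) = diffQuot (1 / (N : ℝ)) z i := fun i => by
    unfold diffQuot; rw [add_right_comm, hz, hz]
  have h := sum_mul_sub_eq hz hv
  have hb := sum_mul_le_ellTwoNorm_mul N z (diffQuot₂ (1 / (N : ℝ)) z)
  have ha : 0 < 1 / (N : ℝ) := by positivity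
  rw [ellTwoNorm_sq]
  refine le_trans (le_of_eq ?_) ((neg_le_abs _).trans hb)
  have e1 : ∀ i, diffQuot (1 / (N : ℝ)) z i - diffQuot (1 / (N : ℝ)) z (i - 1)
      = (1 / (N : ℝ)) * diffQuot₂ (1 / (N : ℝ)) z i := fun i => by
    unfold diffQuot diffQuot₂
    rw [sub_add_cancel]
    field_simp; ring
  have e2 : ∀ i, z (i + 1) - z i = 1 / (N : ℝ) * diffQuot (1 / (N : ℝ)) z i := fun i => by
    unfold diffQuot
    rw [mul_div_cancel₀ _ ha.ne']
  simp only [e1, e2] at h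
  calc _ = ∑ i ∈ Finset.Icc (1 : ℤ) N,
        1 / (N : ℝ) * diffQuot (1 / (N : ℝ)) z i * diffQuot (1 / (N : ℝ)) z i :=
        Finset.sum_congr rfl fun i _ => by ring
    _ = -∑ i ∈ Finset.Icc (1 : ℤ) N, z i * (1 / (N : ℝ) * diffQuot₂ (1 / (N : ℝ)) z i) := by
        rw [h, neg_neg]
    _ = _ := by
        congr 1
        exact Finset.sum_congr rfl fun i _ => by ring

theorem symSum_add_period {N : ℕ} {g g' : ℤ → ℝ} {i : ℤ} (h : ∀ j, g' (j + N) = g j) :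
    symSum g' (i + N) = symSum g i := by
  unfold symSum
  refine tsum_congr fun k => ?_
  rw [add_right_comm, add_sub_right_comm, h, h]

theorem stepM_add_period {L a : ℝ} {N : ℕ} {y : ℤ → ℝ} (hL : ∀ i, y (i + N) = y i + L) (i : ℤ) :
    stepM L a y (i + N) = stepM L a y i := by
  unfold stepM
  rw [symSum_add_period (g := fun j => a / (y j - y i))
    (fun j => by rw [hL, hL, add_sub_add_right_eq_sub])]
  rw [add_right_comm i (N : ℤ) 1, add_sub_right_comm i (N : ℤ) 1, hL, hL, hL]
  simp only [add_sub_add_right_eq_sub]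

theorem stepT_add_period {L a : ℝ} {N : ℕ} {y z : ℤ → ℝ} (hL : ∀ i, y (i + N) = y i + L)
    (hz : ∀ i, z (i + N) = z i) (i : ℤ) : stepT L a y z (i + N) = stepT L a y z i := by
  unfold stepT
  rw [symSum_add_period (g := fun j => a * (z j - z i) / (y j - y i) ^ 2)
    (fun j => by rw [hL, hL, hz, hz, add_sub_add_right_eq_sub])]
  rw [add_right_comm i (N : ℤ) 1, add_sub_right_comm i (N : ℤ) 1, hL, hL, hL, hz, hz, hz]
  simp only [add_sub_add_right_eq_sub]

/-- The energy identity: two summations by parts bring the linearized equation, tested against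
`z`, into divergence form. -/
theorem sum_mul_linRHS_eq {L a : ℝ} {N : ℕ} {y z : ℤ → ℝ} (ha : a ≠ 0)
    (hL : ∀ i, y (i + N) = y i + L) (hz : ∀ i, z (i + N) = z i) :
    ∑ i ∈ Finset.Icc (1 : ℤ) N, a * (z i * linRHS L a y z i)
      = ∑ i ∈ Finset.Icc (1 : ℤ) N, (stepT L a y z i *
          ((z (i + 1) - z i) / (y (i + 1) - y i) - (z i - z (i - 1)) / (y i - y (i - 1)))
        + (z (i + 1) - z i) * ((z (i + 1) - z i) / (y (i + 1) - y i) ^ 2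
          * (stepM L a y (i + 1) - stepM L a y i))) := by
  have hM := stepM_add_period (a := a) hL
  have hT := stepT_add_period (a := a) hL hz
  set G : ℤ → ℝ := fun i => (stepT L a y z (i + 1) - stepT L a y z i) / (y (i + 1) - y i)
    - (z (i + 1) - z i) / (y (i + 1) - y i) ^ 2 * (stepM L a y (i + 1) - stepM L a y i) with hG
  set ζ : ℤ → ℝ := fun i => (z (i + 1) - z i) / (y (i + 1) - y i) with hζ
  have h1 := sum_mul_sub_eq (N := N) (z := z) (F := G) hz (fun i => by
    simp only [hG]
    rw [add_right_comm, hM, hM, hT, hT, hz, hz, hL, hL, add_sub_add_right_eq_sub])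
  have h2 := sum_mul_sub_eq (N := N) (z := stepT L a y z) (F := ζ) hT (fun i => by
    simp only [hζ]
    rw [add_right_comm, hz, hz, hL, hL, add_sub_add_right_eq_sub])
  have e1 : ∀ i, a * (z i * linRHS L a y z i) = z i * (G i - G (i - 1)) := fun i => by
    have h : ∀ x X Y : ℝ, a * (x * (1 / a * X - 1 / a * Y)) = x * (X - Y) := fun x X Y => by
      field_simp
    simp only [hG, linRHS, sub_add_cancel]
    rw [h]; ring
  have e2 : ∀ i, (z i - z (i - 1)) / (y i - y (i - 1)) = ζ (i - 1) := fun i => by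
    simp only [hζ, sub_add_cancel]
  simp only [e1, e2, Finset.sum_add_distrib]
  rw [h1]
  refine Eq.trans ?_ (congrArg (· + _) h2.symm)
  rw [← Finset.sum_neg_distrib, ← Finset.sum_neg_distrib, ← Finset.sum_add_distrib]
  refine Finset.sum_congr rfl fun i _ => ?_
  simp only [hG, hζ]
  ring

/-- The pointwise dissipation: the principal part of the product is `-r p w²`, and Young's
inequality absorbs half of it for the mixed terms. In the application `w` and `v` are the second and
first difference quotients of `z`, `R` is the linearized interaction, and `e`, `f` are the
difference quotients of the coefficients `r`, `p`. -/
theorem energy_density_le {r p e f w v R l c ρ b : ℝ} (hρ : 0 < ρ) (hr : |r| ≤ c)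
    (hp : |p| ≤ c) (he : |e| ≤ c) (hf : |f| ≤ c) (hrp : ρ ≤ r * p) (hl : |l| ≤ b) :
    (-(p * w + f * v) + l * R) * (r * w + e * v) ≤
      -(ρ / 2) * w ^ 2
        + (c ^ 2 + 4 * c ^ 4 / ρ + b ^ 2 * c ^ 2 / ρ + b * c) * (v ^ 2 + R ^ 2) := by
  have hc : 0 ≤ c := (abs_nonneg _).trans hr
  have hb : 0 ≤ b := (abs_nonneg _).trans hl
  have mul_bd : ∀ {x y s t : ℝ}, |x| ≤ s → |y| ≤ t → |x * y| ≤ s * t := by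
    intro x y s t hx hy
    rw [abs_mul]
    exact mul_le_mul hx hy (abs_nonneg _) ((abs_nonneg _).trans hx)
  have young : ∀ {g G : ℝ} (x y : ℝ), |g| ≤ G → g * x * y ≤ ρ / 4 * x ^ 2 + G ^ 2 / ρ * y ^ 2 := by
    intro g G x y hg
    have h1 : g ^ 2 ≤ G ^ 2 := sq_le_sq' (by linarith [neg_abs_le g]) (le_trans (le_abs_self g) hg)
    have h2 : g ^ 2 / ρ * y ^ 2 ≤ G ^ 2 / ρ * y ^ 2 := by gcongr
    have h3 : ρ / 4 * x ^ 2 + g ^ 2 / ρ * y ^ 2 - g * x * y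
        = (ρ * x - 2 * g * y) ^ 2 / (4 * ρ) := by field_simp; ring
    have h4 : 0 ≤ (ρ * x - 2 * g * y) ^ 2 / (4 * ρ) := by positivity
    linarith
  have b1 : |-(r * f + p * e)| ≤ 2 * c ^ 2 := by
    rw [abs_neg]
    refine (abs_add_le _ _).trans ?_
    linarith [mul_bd hr hf, mul_bd hp he]
  have y1 := young w v b1
  have y2 := young w R (mul_bd hl hr)
  have y3 : -(e * f) * v ^ 2 ≤ c ^ 2 * v ^ 2 := by
    refine mul_le_mul_of_nonneg_right ?_ (sq_nonneg v)
    have := mul_bd he hf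
    linarith [neg_abs_le (e * f)]
  have y4 : l * e * (R * v) ≤ b * c * (v ^ 2 + R ^ 2) := by
    have h1 := mul_bd hl he
    have h2 : |R * v| ≤ v ^ 2 + R ^ 2 := by
      rw [abs_le]; constructor <;> nlinarith [sq_nonneg (R + v), sq_nonneg (R - v)]
    exact (le_abs_self _).trans (mul_bd h1 h2)
  have y5 : ρ * w ^ 2 ≤ r * p * w ^ 2 := by gcongr
  have n1 : 0 ≤ c ^ 2 * R ^ 2 := by positivity
  have n2 : 0 ≤ 4 * c ^ 4 / ρ * R ^ 2 := by positivity
  have n3 : 0 ≤ b ^ 2 * c ^ 2 / ρ * v ^ 2 := by positivity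
  have e1 : (2 * c ^ 2) ^ 2 / ρ * v ^ 2 = 4 * c ^ 4 / ρ * v ^ 2 := by ring
  have e2 : (b * c) ^ 2 / ρ * R ^ 2 = b ^ 2 * c ^ 2 / ρ * R ^ 2 := by ring
  rw [e1] at y1
  rw [e2] at y2
  linarith

/-- The dissipation controls every lower order term: the interpolation inequality `V² ≤ Z W` and
the smallness parameter `δ` in the bound of the linearized interaction leave a multiple of `Z²`. -/
theorem exists_absorb {ρ A B k₁ k₂ k₃ : ℝ} (hρ : 0 < ρ) (hA : 0 ≤ A) (hB : 0 ≤ B) :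
    ∃ K, 0 ≤ K ∧ ∀ Z V W R : ℝ, 0 ≤ R → V ^ 2 ≤ Z * W →
      (∀ δ, 0 < δ → R ≤ δ * (k₁ * W + k₂ * V) + k₃ * Z / δ) →
      -(ρ / 2) * W ^ 2 + A * (V ^ 2 + R ^ 2) + B * V ^ 2 ≤ K * Z ^ 2 := by
  -- `D δ²` is the coefficient with which `W²` and `V²` return from `A R²`.
  set D := A * (3 * (k₁ ^ 2 + k₂ ^ 2)) with hD
  have hD0 : 0 ≤ D := by positivity
  set δ := √(ρ / (8 * (D + 1))) with hδ
  have hδ0 : 0 < δ := Real.sqrt_pos.2 (by positivity)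
  have hδ2 : D * δ ^ 2 ≤ ρ / 8 := by
    rw [hδ, Real.sq_sqrt (by positivity), ← mul_div_assoc,
      div_le_div_iff₀ (by positivity) (by positivity)]
    nlinarith
  refine ⟨ρ / 8 + 2 * (A + B) ^ 2 / ρ + A * (3 * (k₃ / δ) ^ 2), by positivity, ?_⟩
  intro Z V W R hR hV hRδ
  have h1 := hRδ δ hδ0
  have h2 : R ^ 2 ≤ 3 * ((δ * k₁ * W) ^ 2 + (δ * k₂ * V) ^ 2 + (k₃ / δ * Z) ^ 2) := by
    have h3 : R ≤ δ * k₁ * W + δ * k₂ * V + k₃ / δ * Z := by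
      refine h1.trans (le_of_eq ?_); ring
    refine (pow_le_pow_left₀ hR h3 2).trans ?_
    nlinarith [sq_nonneg (δ * k₁ * W - δ * k₂ * V), sq_nonneg (δ * k₁ * W - k₃ / δ * Z),
      sq_nonneg (δ * k₂ * V - k₃ / δ * Z)]
  have hV2 : V ^ 2 ≤ W ^ 2 + Z ^ 2 := by nlinarith [sq_nonneg (W - Z), sq_nonneg W, sq_nonneg Z]
  have h3 : A * R ^ 2 ≤ ρ / 8 * (W ^ 2 + (W ^ 2 + Z ^ 2)) + A * (3 * (k₃ / δ) ^ 2) * Z ^ 2 := by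
    have t1 : A * R ^ 2
        ≤ A * (3 * ((δ * k₁ * W) ^ 2 + (δ * k₂ * V) ^ 2 + (k₃ / δ * Z) ^ 2)) := by gcongr
    have t2 : A * (3 * ((δ * k₁ * W) ^ 2 + (δ * k₂ * V) ^ 2 + (k₃ / δ * Z) ^ 2))
        ≤ D * δ ^ 2 * (W ^ 2 + V ^ 2) + A * (3 * (k₃ / δ) ^ 2) * Z ^ 2 := by
      rw [hD]
      have : 0 ≤ A * (3 * δ ^ 2) * (k₁ ^ 2 * V ^ 2 + k₂ ^ 2 * W ^ 2) := by positivity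
      linarith
    have t3 : D * δ ^ 2 * (W ^ 2 + V ^ 2) ≤ ρ / 8 * (W ^ 2 + (W ^ 2 + Z ^ 2)) := by gcongr
    linarith
  have h4 : (A + B) * V ^ 2 ≤ ρ / 8 * W ^ 2 + 2 * (A + B) ^ 2 / ρ * Z ^ 2 := by
    have t1 : (A + B) * V ^ 2 ≤ (A + B) * (Z * W) := by gcongr
    have t2 : ρ / 8 * W ^ 2 + 2 * (A + B) ^ 2 / ρ * Z ^ 2 - (A + B) * (Z * W)
        = (ρ * W - 4 * (A + B) * Z) ^ 2 / (8 * ρ) := by field_simp; ring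
    have t3 : 0 ≤ (ρ * W - 4 * (A + B) * Z) ^ 2 / (8 * ρ) := by positivity
    linarith
  have h5 : 0 ≤ ρ / 8 * W ^ 2 := by positivity
  linarith

/-- The linearized right-hand side is bounded above as a quadratic form on `ℓ²`, uniformly in the
mesh size. -/
theorem exists_sum_mul_linRHS_le {m₁ m₂ : ℝ} (hm₁ : 0 < m₁) (hm₂ : 0 < m₂) :
    ∃ K, 0 ≤ K ∧ ∀ (N : ℕ) (L : ℝ) (y z : ℤ → ℝ), 0 < N →
      IsRegularSteps m₁ m₂ (1 / (N : ℝ)) y → (∀ i, y (i + N) = y i + L) →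
      (∀ i, z (i + N) = z i) →
      ∑ i ∈ Finset.Icc (1 : ℤ) N, 1 / (N : ℝ) * (z i * linRHS L (1 / (N : ℝ)) y z i) ≤
        K * ellTwoNorm N z ^ 2 := by
  obtain ⟨CM, hCM, hM⟩ := exists_abs_stepM_sub_le hm₁ hm₂
  set cr := 1 / m₁ + m₂ / m₁ ^ 2 + 2 * m₂ ^ 2 / m₁ ^ 3 with hcr
  have hcr0 : 0 ≤ cr := by positivity
  -- The coefficient `p = r² + 3 r⁴` inherits discrete `C²` bounds from `r = 1 / h`.
  obtain ⟨cp, hcp0, hcp⟩ : ∃ cp, 0 ≤ cp ∧ ∀ (a : ℝ) (r : ℤ → ℝ), 0 < a → DiscreteC2 a cr r →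
      DiscreteC2 a cp (fun i => r i ^ 2 + 3 * r i ^ 4) := by
    refine ⟨4 * (cr * cr) + (4 * (4 * (cr * cr) * (4 * (cr * cr)))
      + (4 * (4 * (cr * cr) * (4 * (cr * cr))) + 4 * (4 * (cr * cr) * (4 * (cr * cr))))),
      by positivity, fun a r ha hr => ?_⟩
    have h2 := hr.mul ha.le hr
    have h4 := h2.mul ha.le h2
    convert h2.add (h4.add (h4.add h4)) using 2
    ring
  set c := cr + cp with hc
  set ρ := 1 / m₂ ^ 3 with hρ
  have hρ0 : 0 < ρ := by positivity
  set b := 2 / m₁ with hb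
  have hb0 : 0 ≤ b := by positivity
  set A := c ^ 2 + 4 * c ^ 4 / ρ + b ^ 2 * c ^ 2 / ρ + b * c with hA
  have hA0 : 0 ≤ A := by positivity
  obtain ⟨K, hK0, hK⟩ := exists_absorb (ρ := ρ) (A := A) (B := CM / m₁ ^ 2)
    (k₁ := 4 / m₁ ^ 2) (k₂ := 8 * m₂ ^ 2 / m₁ ^ 4) (k₃ := 16 / m₁ ^ 2) hρ0 hA0 (by positivity)
  refine ⟨K, hK0, fun N L y z hN hy hL hz => ?_⟩
  have ha : 0 < 1 / (N : ℝ) := by positivity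
  have hLm := hy.le_period hN hL
  have hL0 : 0 < L := hm₁.trans_le hLm
  have hM' := hM N L y hN hy hL
  set R : ℤ → ℝ := fun i => symSum (fun j => 1 / (N : ℝ) * (z j - z i) / (y j - y i) ^ 2) i
    with hR
  set v := diffQuot (1 / (N : ℝ)) z with hv
  set w := diffQuot₂ (1 / (N : ℝ)) z with hw
  have hv_per : ∀ i, v (i + N) = v i := fun i => by
    simp only [hv, diffQuot]; rw [add_right_comm, hz, hz]
  have hVW := ellTwoNorm_diffQuot_sq_le hN hz
  have hRδ : ∀ δ, 0 < δ → ellTwoNorm N R ≤ δ * (4 / m₁ ^ 2 * ellTwoNorm N w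
      + 8 * m₂ ^ 2 / m₁ ^ 4 * ellTwoNorm N v) + 16 / m₁ ^ 2 * ellTwoNorm N z / δ := by
    intro δ hδ
    refine (ellTwoNorm_symSum_linearized_le hm₁ hδ hN hy hz).trans (le_of_eq ?_)
    ring
  refine le_trans ?_ (hK _ _ _ _ (ellTwoNorm_nonneg N R) hVW hRδ)
  have hv_shift : ellTwoNorm N (fun i => v (i - 1)) = ellTwoNorm N v := by
    simpa using ellTwoNorm_sub_nat hv_per 1
  rw [sum_mul_linRHS_eq ha.ne' hL hz]
  have hsum : -(ρ / 2) * ellTwoNorm N w ^ 2 + A * (ellTwoNorm N v ^ 2 + ellTwoNorm N R ^ 2)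
      + CM / m₁ ^ 2 * ellTwoNorm N v ^ 2 = ∑ i ∈ Finset.Icc (1 : ℤ) N, 1 / (N : ℝ) *
        ((-(ρ / 2) * w i ^ 2 + A * (v (i - 1) ^ 2 + R i ^ 2)) + CM / m₁ ^ 2 * v i ^ 2) := by
    have e1 := ellTwoNorm_sq N w
    have e2 := ellTwoNorm_sq N (fun i => v (i - 1))
    have e3 := ellTwoNorm_sq N R
    have e4 := ellTwoNorm_sq N v
    rw [hv_shift] at e2
    have e : ∑ i ∈ Finset.Icc (1 : ℤ) N, 1 / (N : ℝ) *
        ((-(ρ / 2) * w i ^ 2 + A * (v (i - 1) ^ 2 + R i ^ 2)) + CM / m₁ ^ 2 * v i ^ 2)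
        = -(ρ / 2) * (∑ i ∈ Finset.Icc (1 : ℤ) N, 1 / (N : ℝ) * w i ^ 2)
          + A * (∑ i ∈ Finset.Icc (1 : ℤ) N, 1 / (N : ℝ) * v (i - 1) ^ 2
            + ∑ i ∈ Finset.Icc (1 : ℤ) N, 1 / (N : ℝ) * R i ^ 2)
          + CM / m₁ ^ 2 * ∑ i ∈ Finset.Icc (1 : ℤ) N, 1 / (N : ℝ) * v i ^ 2 := by
      simp only [← Finset.sum_add_distrib, Finset.mul_sum]
      exact Finset.sum_congr rfl fun i _ => by ring
    rw [e, ← e1, ← e2, ← e3, ← e4]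
  rw [hsum]
  refine Finset.sum_le_sum fun i _ => ?_
  have hMi := hM' i
  have hRi : R i = symSum (fun j => 1 / (N : ℝ) * (z j - z i) / (y j - y i) ^ 2) i := rfl
  have hwi : w i = (z (i + 1) - 2 * z i + z (i - 1)) / (1 / (N : ℝ)) ^ 2 := rfl
  have hvi : v i = (z (i + 1) - z i) / (1 / (N : ℝ)) := rfl
  have hvi' : v (i - 1) = (z i - z (i - 1)) / (1 / (N : ℝ)) := by
    rw [hv, diffQuot, sub_add_cancel]
  clear hsum hv_shift hRδ hVW hv_per hM' hK hM
  clear_value R v w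
  revert ha hy hMi hRi hvi hvi' hwi
  clear hR hv hw
  generalize 1 / (N : ℝ) = a
  intro hy ha hMi hRi hwi hvi hvi'
  -- In terms of the scaled widths the two factors of the energy identity are difference quotients
  -- of `p v` and `r v`, with `r = 1 / h` and `p = 1 / h ^ 2 + 3 / h ^ 4`.
  have hr := hy.discreteC2_one_div hm₁ ha
  have hp := hcp a _ ha hr
  set r : ℤ → ℝ := fun i => 1 / stepWidth a y i with hr_def
  have hrlow : ∀ i, 1 / m₂ ≤ r i := fun i =>
    one_div_le_one_div_of_le (hm₁.trans_le (hy.le_stepWidth ha i)) (hy.stepWidth_le ha i)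
  have hrup : ∀ i, r i ≤ 1 / m₁ := fun i =>
    one_div_le_one_div_of_le hm₁ (hy.le_stepWidth ha i)
  have hr0 : ∀ i, 0 < r i := fun i => lt_of_lt_of_le (by positivity) (hrlow i)
  have hyr : ∀ i, y (i + 1) - y i = a / r i := fun i => by
    simp only [hr_def, stepWidth]; field_simp
  have hyr' : y i - y (i - 1) = a / r (i - 1) := by
    have := hyr (i - 1)
    rwa [sub_add_cancel] at this
  have hz1 : z (i + 1) - z i = a * v i := by rw [hvi]; field_simp
  have hz2 : z i - z (i - 1) = a * v (i - 1) := by rw [hvi']; field_simp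
  have hw1 : w i = (v i - v (i - 1)) / a := by rw [hwi, hvi, hvi']; field_simp; ring
  have hr1 := hr.first (i - 1)
  have hp1 := hp.first (i - 1)
  rw [sub_add_cancel] at hr1 hp1
  have hT : stepT L a y z i = -((r i ^ 2 + 3 * r i ^ 4) * w i + ((r i ^ 2 + 3 * r i ^ 4)
      - (r (i - 1) ^ 2 + 3 * r (i - 1) ^ 4)) / a * v (i - 1)) + 2 / L * R i := by
    have q0 := hr0 i
    have q1 := hr0 (i - 1)
    rw [stepT, ← hRi, hyr i, hyr', hz1, hz2, hw1]
    field_simp; ring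
  have hdens := energy_density_le (w := w i) (v := v (i - 1)) (R := R i) (c := c) (b := b)
    (l := 2 / L) (r := r i) (p := r i ^ 2 + 3 * r i ^ 4) (e := (r i - r (i - 1)) / a)
    (f := ((r i ^ 2 + 3 * r i ^ 4) - (r (i - 1) ^ 2 + 3 * r (i - 1) ^ 4)) / a) hρ0
    ((hr.bound i).trans (by linarith)) ((hp.bound i).trans (by linarith))
    (by rw [abs_div, abs_of_pos ha, div_le_iff₀ ha]; exact hr1.trans (by gcongr; linarith))
    (by rw [abs_div, abs_of_pos ha, div_le_iff₀ ha]; exact hp1.trans (by gcongr; linarith))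
    (by
      have h1 : (1 / m₂) ^ 3 ≤ r i ^ 3 := by gcongr; exact hrlow i
      have h2 : 0 ≤ 3 * r i ^ 5 := by have := hr0 i; positivity
      have h3 : (1 / m₂) ^ 3 = 1 / m₂ ^ 3 := by ring
      rw [hρ, ← h3]
      linarith)
    (by rw [abs_of_nonneg (by positivity)]; exact div_le_div_of_nonneg_left (by norm_num) hm₁ hLm)
  rw [← hT] at hdens
  have hζ : (z (i + 1) - z i) / (y (i + 1) - y i) - (z i - z (i - 1)) / (y i - y (i - 1))
      = a * (r i * w i + (r i - r (i - 1)) / a * v (i - 1)) := by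
    have q0 := hr0 i
    have q1 := hr0 (i - 1)
    rw [hyr i, hyr', hz1, hz2, hw1]
    field_simp; ring
  have hlast : (z (i + 1) - z i) * ((z (i + 1) - z i) / (y (i + 1) - y i) ^ 2
      * (stepM L a y (i + 1) - stepM L a y i)) ≤ a * (CM / m₁ ^ 2 * v i ^ 2) := by
    have q0 := hr0 i
    have e : (z (i + 1) - z i) * ((z (i + 1) - z i) / (y (i + 1) - y i) ^ 2
        * (stepM L a y (i + 1) - stepM L a y i))
        = (stepM L a y (i + 1) - stepM L a y i) * (r i ^ 2 * v i ^ 2) := by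
      rw [hyr i, hz1]
      field_simp
    rw [e]
    calc _ ≤ CM * a * ((1 / m₁) ^ 2 * v i ^ 2) := by
          refine mul_le_mul ((le_abs_self _).trans hMi) ?_ (by positivity) (by positivity)
          gcongr
          exact hrup i
      _ = _ := by ring
  rw [hζ]
  refine (add_le_add ?_ hlast).trans_eq (mul_add _ _ _).symm
  calc _ = a * (stepT L a y z i * (r i * w i + (r i - r (i - 1)) / a * v (i - 1))) := by ring
    _ ≤ _ := mul_le_mul_of_nonneg_left hdens ha.le

/-! ### Nodal values of a smooth profile -/

/-- An `n`-th difference is bounded by the `n`-th derivative. -/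
theorem abs_fwdDiff_iter_le {h : ℝ} (n : ℕ) : ∀ {f : ℝ → ℝ} {C : ℝ}, ContDiff ℝ n f →
    (∀ x, |iteratedDeriv n f x| ≤ C) → ∀ x, |(fwdDiff h)^[n] f x| ≤ C * |h| ^ n := by
  induction n with
  | zero => intro f C _ hb x; simpa using hb x
  | succ n ih =>
    intro f C hf hb x
    have hfn : ContDiff ℝ n f := hf.of_le (by exact_mod_cast n.le_succ)
    have hsh : ContDiff ℝ n (fun x => f (x + h)) := hfn.comp (contDiff_id.add contDiff_const)
    have hd : Differentiable ℝ (iteratedDeriv n f) :=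
      hf.differentiable_iteratedDeriv n (by exact_mod_cast n.lt_succ_self)
    have key : ∀ x, |iteratedDeriv n (fwdDiff h f) x| ≤ C * |h| := by
      intro x
      have e : iteratedDeriv n (fwdDiff h f) x = iteratedDeriv n f (x + h) - iteratedDeriv n f x := by
        have h1 : fwdDiff h f = (fun x => f (x + h)) - f := rfl
        rw [h1, iteratedDeriv_sub hsh.contDiffAt hfn.contDiffAt, iteratedDeriv_comp_add_const]
      rw [e]
      have := Convex.norm_image_sub_le_of_norm_deriv_le (f := iteratedDeriv n f) (s := univ) (C := C)
        (x := x) (y := x + h) (fun x _ => hd x)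
        (fun x _ => by rw [← iteratedDeriv_succ]; exact hb x) convex_univ trivial trivial
      simpa using this
    have := ih (f := fwdDiff h f) (hsh.sub hfn) key x
    rw [Function.iterate_succ_apply, pow_succ]
    linarith

theorem forall_abs_le_of_ae {f : ℝ → ℝ} {C : ℝ} (hf : Continuous f)
    (h : ∀ᵐ x : ℝ, |f x| ≤ C) (x : ℝ) : |f x| ≤ C := by
  have hd := Measure.dense_of_ae h
  have hc : IsClosed {x | |f x| ≤ C} := isClosed_le hf.abs continuous_const
  have := hd.closure_eq
  rw [hc.closure_eq] at this
  exact (Set.ext_iff.1 this x).2 (mem_univ x)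

/-- The nodes `(N - i) / N` decrease in `i`, so a decreasing profile has increasing nodal values, and
the forward differences of these are differences of `f` with step `-1 / N`. -/
theorem isRegularSteps_nodal {m₁ m₂ : ℝ} {N : ℕ} {f : ℝ → ℝ} (hN : 0 < N) (hf : ContDiff ℝ 3 f)
    (h1 : ∀ x, deriv f x ≤ -m₁) (hb : ∀ n ∈ Finset.Icc 1 3, ∀ x, |iteratedDeriv n f x| ≤ m₂) :
    IsRegularSteps m₁ m₂ (1 / (N : ℝ)) (nodal N f) := by
  have hN' : (0 : ℝ) < N := by positivity
  have ha : 0 < 1 / (N : ℝ) := by positivity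
  have hnod : ∀ i : ℤ, nodal N f (i + 1) = f (((N : ℝ) - i) / N + -(1 / (N : ℝ))) := fun i => by
    unfold nodal; congr 1; push_cast; field_simp; ring
  have hnod2 : ∀ i : ℤ, nodal N f (i + 2)
      = f (((N : ℝ) - i) / N + -(1 / (N : ℝ)) + -(1 / (N : ℝ))) := fun i => by
    unfold nodal; congr 1; push_cast; field_simp; ring
  have hnod3 : ∀ i : ℤ, nodal N f (i + 3)
      = f (((N : ℝ) - i) / N + -(1 / (N : ℝ)) + -(1 / (N : ℝ)) + -(1 / (N : ℝ))) := fun i => by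
    unfold nodal; congr 1; push_cast; field_simp; ring
  have hcd : ∀ n : ℕ, n ∈ Finset.Icc 1 3 → ContDiff ℝ n f := fun n hn =>
    hf.of_le (by simp only [Finset.mem_Icc] at hn; exact_mod_cast hn.2)
  have hD : ∀ n : ℕ, n ∈ Finset.Icc 1 3 → ∀ i : ℤ,
      |(fwdDiff (-(1 / (N : ℝ))))^[n] f (((N : ℝ) - i) / N)| ≤ m₂ * (1 / (N : ℝ)) ^ n := by
    intro n hn i
    have := abs_fwdDiff_iter_le (h := -(1 / (N : ℝ))) n (hcd n hn) (hb n hn) (((N : ℝ) - i) / N)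
    rwa [abs_neg, abs_of_pos ha] at this
  refine ⟨fun i => ?_, fun i => ?_, fun i => ?_, fun i => ?_⟩
  · have := Convex.image_sub_le_mul_sub_of_deriv_le (f := f) (D := univ) convex_univ
      hf.continuous.continuousOn (hf.differentiable (by norm_num)).differentiableOn
      (C := -m₁) (fun x _ => h1 x) (((N : ℝ) - i) / N + -(1 / (N : ℝ))) trivial
      (((N : ℝ) - i) / N) trivial (by linarith)
    rw [hnod]
    unfold nodal
    linarith
  · have := (le_abs_self _).trans (hD 1 (by simp) i)
    rw [hnod]
    simpa [fwdDiff, nodal] using this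
  · have := hD 2 (by simp) (i - 1)
    have e : i + 1 = i - 1 + 2 := by ring
    have e' : nodal N f i = nodal N f (i - 1 + 1) := by rw [sub_add_cancel]
    rw [e, hnod2, e', hnod]
    convert this using 2
    simp only [Function.iterate_succ, Function.iterate_zero, Function.comp, id, fwdDiff, nodal]
    ring
  · have := hD 3 (by simp) (i - 1)
    have e : i + 2 = i - 1 + 3 := by ring
    have e' : i + 1 = i - 1 + 2 := by ring
    have e'' : nodal N f i = nodal N f (i - 1 + 1) := by rw [sub_add_cancel]
    rw [e, hnod3, e', hnod2, e'', hnod]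
    convert this using 2
    simp only [Function.iterate_succ, Function.iterate_zero, Function.comp, id, fwdDiff, nodal]
    ring

theorem nodal_add_period {L : ℝ} {N : ℕ} {f : ℝ → ℝ} (hN : 0 < N)
    (hf : ∀ α, f (α + 1) - f α = -L) (i : ℤ) : nodal N f (i + N) = nodal N f i + L := by
  have hN' : (0 : ℝ) < N := by positivity
  have h := hf (((N : ℝ) - (i + N : ℤ)) / N)
  have e : ((N : ℝ) - (i + N : ℤ)) / N + 1 = ((N : ℝ) - i) / N := by
    push_cast; field_simp; ring
  rw [e] at h
  unfold nodal
  linarith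

/-! ### Evolution in time -/

theorem forall_Icc_le_of_ae {T : ℝ} {f g : ℝ → ℝ} (hT : 0 < T) (hf : ContinuousOn f (Icc 0 T))
    (hg : ContinuousOn g (Icc 0 T)) (h : ∀ᵐ t ∂(volume.restrict (Icc 0 T)), f t ≤ g t) :
    ∀ t ∈ Icc 0 T, f t ≤ g t := by
  have := Measure.eqOn_Icc_of_ae_eq volume hT.ne (f := f) (g := fun t => min (f t) (g t))
    (h.mono fun t ht => (min_eq_left ht).symm) hf (hf.inf hg)
  intro t ht
  rw [this ht]
  exact min_le_right _ _

/-- The profile bounds hold for almost every time only; the discrete bounds that they imply pass to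
every time by continuity, as is needed to use them along the linearized flow. -/
theorem regularSteps_of_strongSolution {m₁ m₂ T L : ℝ} {φ : ℝ → ℝ → ℝ} (hT : 0 < T)
    (hφ : IsStrongSolution L T φ) (hb : HasProfileBounds m₁ m₂ T φ) {N : ℕ} (hN : 0 < N) :
    ∀ t ∈ Icc 0 T, IsRegularSteps m₁ m₂ (1 / (N : ℝ)) (nodal N (φ t)) ∧
      ∀ i, nodal N (φ t) (i + N) = nodal N (φ t) i + L := by
  obtain ⟨K, hK⟩ := hφ.lipschitz_time
  have hc : ∀ i, ContinuousOn (fun t => nodal N (φ t) i) (Icc 0 T) := fun i =>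
    (hK _).continuousOn
  have hae : ∀ᵐ t ∂(volume.restrict (Icc 0 T)),
      IsRegularSteps m₁ m₂ (1 / (N : ℝ)) (nodal N (φ t)) ∧
      ∀ i, nodal N (φ t) (i + N) = nodal N (φ t) i + L := by
    filter_upwards [hφ.profile, hb] with t hp hbt
    refine ⟨isRegularSteps_nodal hN (hp.contDiff.of_le (by norm_num)) hbt.1 fun n hn => ?_,
      nodal_add_period hN hp.quasiPeriodic⟩
    simp only [Finset.mem_Icc] at hn
    refine forall_abs_le_of_ae (hp.contDiff.continuous_iteratedDeriv n ?_)
      (hbt.2 n (by simp only [Finset.mem_Icc]; omega))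
    exact_mod_cast hn.2.trans (by norm_num)
  -- The inequalities are closed conditions on finitely many nodal values, continuous in time.
  have habs : ∀ {F : ℝ → ℝ} {c : ℝ}, ContinuousOn F (Icc 0 T) →
      (∀ᵐ t ∂(volume.restrict (Icc 0 T)), |F t| ≤ c) → ∀ t ∈ Icc 0 T, |F t| ≤ c :=
    fun hF h => forall_Icc_le_of_ae hT hF.abs continuousOn_const h
  intro t ht
  refine ⟨⟨fun i => ?_, fun i => ?_, fun i => ?_, fun i => ?_⟩, fun i => ?_⟩
  · exact forall_Icc_le_of_ae hT continuousOn_const ((hc _).sub (hc _))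
      (hae.mono fun t h => h.1.lower i) t ht
  · exact forall_Icc_le_of_ae hT ((hc _).sub (hc _)) continuousOn_const
      (hae.mono fun t h => h.1.upper i) t ht
  · exact habs (((hc _).sub ((hc _).const_mul 2)).add (hc _))
      (hae.mono fun t h => h.1.second i) t ht
  · exact habs ((((hc _).sub ((hc _).const_mul 3)).add ((hc _).const_mul 3)).sub (hc _))
      (hae.mono fun t h => h.1.third i) t ht
  · exact Measure.eqOn_Icc_of_ae_eq volume hT.ne (hae.mono fun t h => h.2 i) (hc _)
      ((hc _).add continuousOn_const) ht

/-- Grönwall's inequality for the squared norm. -/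
theorem ellTwoNorm_le_of_sum_mul_le {N : ℕ} {T K : ℝ} {z z' : ℝ → ℤ → ℝ} (hK : 0 ≤ K)
    (hz : ∀ t ∈ Icc 0 T, ∀ i, HasDerivWithinAt (fun s => z s i) (z' t i) (Icc 0 T) t)
    (h : ∀ t ∈ Icc 0 T, ∑ i ∈ Finset.Icc (1 : ℤ) N, 1 / (N : ℝ) * (z t i * z' t i) ≤
      K * ellTwoNorm N (z t) ^ 2) :
    ∀ t ∈ Icc 0 T, ellTwoNorm N (z t) ≤ Real.exp (K * T) * ellTwoNorm N (z 0) := by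
  set G : ℝ → ℝ := fun t => Real.exp (-(2 * K) * t) * ellTwoNorm N (z t) ^ 2 with hG
  have hder : ∀ t ∈ Icc 0 T, HasDerivWithinAt G
      (Real.exp (-(2 * K) * t) * (-(2 * K)) * ellTwoNorm N (z t) ^ 2 + Real.exp (-(2 * K) * t) *
        (2 * ∑ i ∈ Finset.Icc (1 : ℤ) N, 1 / (N : ℝ) * (z t i * z' t i))) (Icc 0 T) t := by
    intro t ht
    have h1 : HasDerivWithinAt (fun t => Real.exp (-(2 * K) * t))
        (Real.exp (-(2 * K) * t) * (-(2 * K))) (Icc 0 T) t := by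
      simpa using (((hasDerivAt_id t).const_mul (-(2 * K))).exp).hasDerivWithinAt
    have h2 : HasDerivWithinAt (fun t => ellTwoNorm N (z t) ^ 2)
        (2 * ∑ i ∈ Finset.Icc (1 : ℤ) N, 1 / (N : ℝ) * (z t i * z' t i)) (Icc 0 T) t := by
      simp only [ellTwoNorm_sq]
      have := HasDerivWithinAt.fun_sum (u := Finset.Icc (1 : ℤ) N) (fun i _ =>
        (((hz t ht i).fun_pow 2).const_mul (1 / (N : ℝ))))
      refine this.congr_deriv ?_
      rw [Finset.mul_sum]
      exact Finset.sum_congr rfl fun i _ => by simp; ring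
    exact h1.mul h2
  have hanti : AntitoneOn G (Icc 0 T) := by
    refine antitoneOn_of_deriv_nonpos (convex_Icc 0 T)
      (fun t ht => (hder t ht).continuousWithinAt)
      (fun t ht => ((hder t (interior_subset ht)).mono interior_subset).differentiableWithinAt)
      (fun t ht => ?_)
    have ht' := interior_subset ht
    rw [interior_Icc] at ht
    rw [((hder t ht').hasDerivAt (Icc_mem_nhds ht.1 ht.2)).deriv]
    have := mul_le_mul_of_nonneg_left (h t ht') (Real.exp_pos (-(2 * K) * t)).le
    linarith
  intro t ht
  have h0 : (0 : ℝ) ∈ Icc 0 T := ⟨le_rfl, ht.1.trans ht.2⟩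
  have hle := hanti h0 ht ht.1
  simp only [hG, mul_zero, Real.exp_zero, one_mul] at hle
  refine le_of_sq_le_sq ?_ (mul_nonneg (Real.exp_pos _).le (ellTwoNorm_nonneg _ _))
  have e1 : Real.exp (2 * K * t) * Real.exp (-(2 * K) * t) = 1 := by
    rw [← Real.exp_add]; simp
  have e2 : Real.exp (2 * K * t) ≤ Real.exp (K * T) ^ 2 := by
    rw [← Real.exp_nat_mul]
    apply Real.exp_le_exp.2
    have := mul_le_mul_of_nonneg_left ht.2 hK
    push_cast; linarith
  calc ellTwoNorm N (z t) ^ 2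
      = Real.exp (2 * K * t) * (Real.exp (-(2 * K) * t) * ellTwoNorm N (z t) ^ 2) := by
        rw [← mul_assoc, e1, one_mul]
    _ ≤ Real.exp (2 * K * t) * ellTwoNorm N (z 0) ^ 2 := by gcongr
    _ ≤ Real.exp (K * T) ^ 2 * ellTwoNorm N (z 0) ^ 2 := by gcongr
    _ = _ := by ring

theorem mainTheorem9 (m₁ m₂ T : ℝ) (hm₁ : 0 < m₁) (hm₂ : 0 < m₂) (hT : 0 < T) :
    ∃ C : ℝ, 0 < C ∧
      ∀ (L : ℝ), 0 < L → ∀ φ : ℝ → ℝ → ℝ,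
        IsStrongSolution L T φ → HasProfileBounds m₁ m₂ T φ →
        ∀ N : ℕ, 1 ≤ N → ∀ z : ℝ → ℤ → ℝ,
          IsLinearizedSolution N L T (fun t => nodal N (φ t)) z →
          ∀ t ∈ Icc 0 T, ellTwoNorm N (z t) ≤ C * ellTwoNorm N (z 0) := by
  obtain ⟨K, hK0, hK⟩ := exists_sum_mul_linRHS_le hm₁ hm₂
  refine ⟨Real.exp (K * T), Real.exp_pos _, fun L _ φ hφ hb N hN z hz => ?_⟩
  have hreg := regularSteps_of_strongSolution hT hφ hb (N := N) hN
  exact ellTwoNorm_le_of_sum_mul_le hK0 hz.ode fun t ht =>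
    hK N L _ _ hN (hreg t ht).1 (hreg t ht).2 (hz.periodic t ht)
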